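/- Conventions. Submanifolds are smooth, embedded and without boundary, not necessarily complete. For a $k$-dimensional submanifold $M\subset\mathbb R^{N}$ and a smooth $1$-form $\mu$ on $M$, the pair $(M,\mu)$ is a *twisted-austere pair* with phase $e^{\mathrm i\theta}$ if $N^*M+\mu=\{(x,\xi+\mu_x) : x\in M,\ \xi\in N^*_xM\}$ is a special Lagrangian submanifold of $T^*\mathbb R^{N}=\mathbb C^{N}$ with phase $e^{\mathrm i\theta}$, i.e. an $N$-dimensional submanifold on which the symplectic form and $\operatorname{Im}(e^{\mathrm i\theta}dz^1\wedge\dots\wedge dz^{N})$ vanish; its cophase is $\phi=\theta-(N-k)\frac{\pi}{2}$. A submanifold is *austere* if for every normal vector $\nu$ all odd elementary symmetric functions of the eigenvalues of the second fundamental form $A^\nu$ in direction $\nu$ vanish. The Laplacian is $\Delta=\operatorname{tr}\nabla d$. "$\tan\phi=0$" includes $\cos\phi\ne0$. **Theorem.** Let $n\ge 0$ and $v\in\mathbb R^{n+1}$, and for $x\ne v$ put $s=|x-v|$ and $\mathsf e_0=(x-v)/s$. (1) Let $\Sigma\subset S^n$ be a subset of the unit sphere and $I\subset(0,\infty)$ an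 open interval (with $I=(0,\infty)$ for the full cone) such that $M=\{v+sy : y\in\Sigma,\ s\in I\}$ is a connected $3$-dimensional submanifold of $\mathbb R^{n+1}$, and let $\mu$ be a smooth $1$-form on $M$ such that $(M,\mu)$ is a twisted-austere pair with phase $e^{\mathrm i\theta}$. Assume that $M$ is austere and not totally geodesic, and that $(M,\mu)$ is of split type: $(\nabla\mu)(\mathsf e_0,w)=(\nabla\mu)(w,\mathsf e_0)=0$ for every tangent vector $w$ of $M$ orthogonal to $\mathsf e_0$. Then $\tan\phi=0$, the link $\Sigma$ is a minimal surface in $S^n$, and the slope $\mu(\mathsf e_0)$ is constant along the rulings, so that $\mu(\mathsf e_0)(v+sy)=m(y)$ for a smooth function $m$ on $\Sigma$; moreover $$\Delta m=-2m \quad\text{on } \Sigma \qquad\text{and}\qquad \mu=d(ms)\quad\text{on } M .$$ (2) Conversely, let $\Sigma\subset S^n$ be any minimal surface and $m$ any smooth function on $\Sigma$ with $\Delta m=-2m$. Let $M=\{v+sy : y\in\Sigma,\ s>0\}$ be the cone over $\Sigma$, and extend $m$ to $M$ to be constant along the rulings. Then $\mu=d(ms)$ is a smooth $1$-form on $M$,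 and $(M,\mu)$ is a twisted-austere pair with $\tan\phi=0$, that is, with phase $e^{\mathrm i\theta}$ for every $\theta$ such that $\tan\phi=0$. -/

import Mathlib

open scoped ContDiff InnerProductSpace

noncomputable section

namespace TwistedAustere

/-! ### Embedded submanifolds, given as subsets -/

section Submanifolds

variable {F : Type*} [NormedAddCommGroup F] [NormedSpace ℝ F]

/-- `M` is a smooth embedded `k`-dimensional submanifold (without boundary) of `F`: near each of its
points there is a smooth chart `Φ` of `F`, with smooth inverse, in which `M` is a `k`-dimensional
linear subspace. -/
def IsSubmanifold (k : ℕ) (M : Set F) : Prop :=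
  ∀ x ∈ M, ∃ Φ : OpenPartialHomeomorph F F, x ∈ Φ.source ∧
    ContDiffOn ℝ ∞ Φ Φ.source ∧ ContDiffOn ℝ ∞ Φ.symm Φ.target ∧
    ∃ V : Submodule ℝ F, Module.finrank ℝ V = k ∧ ∀ y ∈ Φ.source, y ∈ M ↔ Φ y ∈ V

/-- The tangent space `T_x M`. For a submanifold the tangent cone is already a linear subspace, so
that the span adds nothing. -/
def tangentSpace (M : Set F) (x : F) : Submodule ℝ F :=
  Submodule.span ℝ (tangentConeAt ℝ M x)

end Submanifolds

/-- Euclidean space `ℝ^N`. -/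
abbrev E (N : ℕ) := EuclideanSpace ℝ (Fin N)

/-- The cotangent bundle `T^* ℝ^N = ℝ^N × (ℝ^N)^*`. -/
abbrev CotangentBundle (N : ℕ) := E N × (E N →L[ℝ] ℝ)

/-! ### Special Lagrangian submanifolds of `T^* ℝ^N` -/

section SpecialLagrangian

variable {N : ℕ}

/-- The canonical symplectic form `∑ dx^j ∧ dξ_j` on `T^* ℝ^N`. -/
def canonicalSymplectic (a b : CotangentBundle N) : ℝ :=
  b.2 a.1 - a.2 b.1

/-- The holomorphic volume form `dz^1 ∧ ⋯ ∧ dz^N` on `T^* ℝ^N = ℂ^N`, `z^k = x^k + i ξ_k`. -/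
def holomorphicVolume (w : Fin N → CotangentBundle N) : ℂ :=
  (Matrix.of fun j k : Fin N =>
    (((w j).1 k : ℝ) : ℂ) +
      Complex.I * (((w j).2 (EuclideanSpace.single k 1) : ℝ) : ℂ)).det

/-- `L` is (for a suitable orientation) a special Lagrangian submanifold of `T^* ℝ^N` with phase
`e^{iθ}`, i.e. calibrated by `Re (e^{iθ} dz^1 ∧ ⋯ ∧ dz^N)`: it is an `N`-dimensional submanifold on
which both the symplectic form and `Im (e^{iθ} dz^1 ∧ ⋯ ∧ dz^N)` vanish. -/
def IsSpecialLagrangian (θ : ℝ) (L : Set (CotangentBundle N)) : Prop :=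
  IsSubmanifold N L ∧ ∀ p ∈ L,
    (∀ a ∈ tangentSpace L p, ∀ b ∈ tangentSpace L p, canonicalSymplectic a b = 0) ∧
    ∀ w : Fin N → CotangentBundle N, (∀ j, w j ∈ tangentSpace L p) →
      (Complex.exp (θ * Complex.I) * holomorphicVolume w).im = 0

end SpecialLagrangian

/-! ### Twisted-austere pairs

A `1`-form on a submanifold `M` of `ℝ^N` is given by a function `μ` with values in `(ℝ^N)^*`; only
the restrictions of `μ x` to `T_x M`, for `x ∈ M`, play a role. -/

section Pairs

variable {N : ℕ}

/-- The twisted conormal bundle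
`N^*M + μ = {(x, ξ + μ_x) | x ∈ M, ξ ∈ N_x^* M}`. -/
def twistedConormal (M : Set (E N)) (μ : E N → (E N →L[ℝ] ℝ)) : Set (CotangentBundle N) :=
  {p | p.1 ∈ M ∧ ∃ ξ : E N →L[ℝ] ℝ,
    (∀ w ∈ tangentSpace M p.1, ξ w = 0) ∧ p.2 = ξ + μ p.1}

/-- `(M, μ)` is a twisted-austere pair with phase `e^{iθ}`: `M` is a `k`-dimensional submanifold of
`ℝ^N`, `μ` is a smooth `1`-form on `M`, and `N^*M + μ` is special Lagrangian with phase `e^{iθ}`. -/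
structure IsTwistedAusterePair (k : ℕ) (θ : ℝ) (M : Set (E N)) (μ : E N → (E N →L[ℝ] ℝ)) :
    Prop where
  submanifold : IsSubmanifold k M
  smooth : ContDiffOn ℝ ∞ μ M
  specialLagrangian : IsSpecialLagrangian θ (twistedConormal M μ)

/-- The cophase angle `φ = θ - (N - k) π / 2` of a pair with a `k`-dimensional base in `ℝ^N`. -/
def cophase (N k : ℕ) (θ : ℝ) : ℝ := θ - ((N : ℝ) - (k : ℝ)) * (Real.pi / 2)

end Pairs

/-! ### Submanifold geometry in `ℝ^N` -/

section Geometry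

variable {N : ℕ}

/-- The tangent vector field `y ↦ P_y w` on `M`, where `P_y` is the orthogonal projection onto
`T_y M`. For `w ∈ T_x M` it extends `w`. -/
def tangentExtension (M : Set (E N)) (w : E N) (y : E N) : E N :=
  (tangentSpace M y).starProjection w

/-- The derivative `D_v W` at `x` of the field `W = tangentExtension M w`, for `v ∈ T_x M`. -/
def derivExtension (M : Set (E N)) (x v w : E N) : E N :=
  fderivWithin ℝ (tangentExtension M w) M x v

/-- The second fundamental form `II(v, w) = (D_v W)^⊥` of `M` at `x`, for `v, w ∈ T_x M`, where the
tangent vector field `W` extends `w`. -/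
def secondFundamentalForm (M : Set (E N)) (x v w : E N) : E N :=
  (tangentSpace M x)ᗮ.starProjection (derivExtension M x v w)

/-- The covariant derivative `(∇_v α)(w) = v (α(W)) - α (∇_v W)` at `x` of a `1`-form `α` on `M`,
for `v, w ∈ T_x M`. Here the tangent vector field `W` extends `w`, and `∇_v W = (D_v W)^⊤` is the
Levi-Civita connection of the induced metric. -/
def covariantDerivative (M : Set (E N)) (α : E N → (E N →L[ℝ] ℝ)) (x v w : E N) : ℝ :=
  fderivWithin ℝ (fun y => α y (tangentExtension M w y)) M x v -
    α x ((tangentSpace M x).starProjection (derivExtension M x v w))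

/-- The Laplacian `Δ f = tr ∇ df` on `M`, with respect to the induced metric. -/
def laplacian (M : Set (E N)) (f : E N → ℝ) (x : E N) : ℝ :=
  let b := stdOrthonormalBasis ℝ (tangentSpace M x)
  ∑ i, covariantDerivative M (fun y => fderivWithin ℝ f M y) x (b i : E N) (b i : E N)

/-- The matrix of `A^ν = ν · II` at `x` in an orthonormal basis of `T_x M`. -/
def shapeMatrix (M : Set (E N)) (x ν : E N) :
    Matrix (Fin (Module.finrank ℝ (tangentSpace M x)))
      (Fin (Module.finrank ℝ (tangentSpace M x))) ℝ :=
  let b := stdOrthonormalBasis ℝ (tangentSpace M x)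
  Matrix.of fun i j => ⟪ν, secondFundamentalForm M x (b i : E N) (b j : E N)⟫_ℝ

/-- `M` is austere: for each normal vector `ν` the elementary symmetric functions of odd degree of
the eigenvalues of `A^ν` vanish. (The one of degree `j` is, up to sign, the coefficient of
degree `dim M - j` of the characteristic polynomial.) -/
def IsAustere (M : Set (E N)) : Prop :=
  ∀ x ∈ M, ∀ ν ∈ (tangentSpace M x)ᗮ, ∀ j ≤ Module.finrank ℝ (tangentSpace M x), Odd j →
    (shapeMatrix M x ν).charpoly.coeff (Module.finrank ℝ (tangentSpace M x) - j) = 0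

/-- `M` is totally geodesic: its second fundamental form vanishes. -/
def IsTotallyGeodesic (M : Set (E N)) : Prop :=
  ∀ x ∈ M, ∀ v ∈ tangentSpace M x, ∀ w ∈ tangentSpace M x, secondFundamentalForm M x v w = 0

/-- `S` is a minimal surface in the unit sphere: a `2`-dimensional submanifold contained in the
sphere such that the trace of its second fundamental form in the sphere vanishes. The latter form is
the component of `II` tangent to the sphere. -/
structure IsMinimalSurfaceInSphere (S : Set (E N)) : Prop where
  subset_sphere : S ⊆ Metric.sphere 0 1
  submanifold : IsSubmanifold 2 S
  minimal : ∀ y ∈ S,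
    ∑ i, (ℝ ∙ y)ᗮ.starProjection (secondFundamentalForm S y
      (stdOrthonormalBasis ℝ (tangentSpace S y) i : E N)
      (stdOrthonormalBasis ℝ (tangentSpace S y) i : E N)) = 0

end Geometry

/-! ### Cones -/

section Cones

variable {N : ℕ}

/-- The part `{v + s y | s ∈ I, y ∈ S}` of the cone over `S` with vertex `v`; the cone itself is
obtained for `I = (0, ∞)`. -/
def coneOver (v : E N) (I : Set ℝ) (S : Set (E N)) : Set (E N) :=
  {x | ∃ s ∈ I, ∃ y ∈ S, x = v + s • y}

/-- The unit vector field `e_0` along the rulings of a cone with vertex `v`, pointing away from the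
vertex. -/
def rulingVector (v x : E N) : E N := ‖x - v‖⁻¹ • (x - v)

/-- The slope `e_0 ⌟ μ` of a pair whose base is a cone with vertex `v`. -/
def slope (v : E N) (μ : E N → (E N →L[ℝ] ℝ)) (x : E N) : ℝ := μ x (rulingVector v x)

/-- For a cone `M` with vertex `v`, the tensor `∇μ` is split: `(∇μ)(e_0, w) = 0` for all tangent
vectors `w` orthogonal to `e_0`. -/
def IsSplit (v : E N) (M : Set (E N)) (μ : E N → (E N →L[ℝ] ℝ)) : Prop :=
  ∀ x ∈ M, ∀ w ∈ tangentSpace M x, ⟪rulingVector v x, w⟫_ℝ = 0 →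
    covariantDerivative M μ x (rulingVector v x) w = 0 ∧
    covariantDerivative M μ x w (rulingVector v x) = 0

/-- The function `m s` on the cone over `S` with vertex `v`, where `m` is a function on `S`, extended
to be constant along the rulings, and `s` is the distance to the vertex. -/
def homogeneousExtension (v : E N) (m : E N → ℝ) (x : E N) : ℝ :=
  ‖x - v‖ * m (rulingVector v x)

/-- `μ = df` as `1`-forms on `M`. -/
def IsDifferentialOn (M : Set (E N)) (f : E N → ℝ) (μ : E N → (E N →L[ℝ] ℝ)) : Prop :=
  ∀ x ∈ M, HasFDerivWithinAt f (μ x) M x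

end Cones

end TwistedAustere

end

/-! A tangent vector of `N^*M + μ` at `(x, ζ)` is a pair `(a, β)` with `a` tangent to `M` and `β`
equal to `(∇μ)(a, ·) - ζ(II(a, ·))` on `T_x M` (`mem_tangentSpace_twistedConormal`). As `II` is
symmetric, the bundle is Lagrangian iff `∇μ` is symmetric, and the phase condition becomes `Im
(e^{iφ} det (1 + i (∇μ - A^ν))) = 0` for every normal `ν` (`isSpecialLagrangian_iff`).

On a cone the ruling direction lies in the kernel of every `A^ν`, so for split `∇μ` the matrix
consists of the number `b = (∇μ)(e₀, e₀)` and a `2 × 2` block. Austerity makes the block of `A^ν`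
trace-free. With `τν` in place of `ν`, the condition is a quadratic polynomial in `τ`. Where `II ≠
0`, its leading coefficient gives `sin φ + b cos φ = 0`, and what is left says that the block of
`∇μ` is trace-free (`splitPhase_family_eq_zero`).

The equation `(∇μ)(e₀, w) = 0` makes `μ(w)` constant along rulings, and `(∇μ)(w, e₀) = 0` says that
at each distance `s` the slope, as a function on the link, has differential `μ`. Slopes at two
distances thus have the same differential, their difference is constant on the connected link, and
`b` depends on `s` only. Let `m` be the slope at a fixed distance. By `laplacian_link`, `Δm` is `s`
times the trace of the block of `∇μ` at distance `s`, minus twice the slope there. On one ruling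
with `II ≠ 0` the trace vanishes, so the slope is `-Δm / 2` at all distances and `b = 0` on this
ruling, hence everywhere. Therefore `sin φ = 0`, and the equation for `ν = 0` makes the trace vanish
at every point, also where `II = 0`. This gives `Δm = -2m` and `μ = d(ms)`.

Conversely, for `μ = d(ms)` the Hessian is split with `b = 0`, both blocks are trace-free by the two
hypotheses, and with `sin φ = 0` every term of the phase condition vanishes.

The submanifold calculus rests on local smooth retractions `r` onto `M`: the tangent space is the
range of `Dr`, and the orthogonal projection onto it is a smooth function of `Dr`. -/

noncomputable section

namespace TwistedAustere

/-! ### Local smooth retractions -/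

section Retractions

variable {F : Type*} [NormedAddCommGroup F] [NormedSpace ℝ F]
  {G : Type*} [NormedAddCommGroup G] [NormedSpace ℝ G]

/-- `r` is a smooth retraction of the open set `U` onto `M ∩ U`. -/
structure IsRetraction (M U : Set F) (r : F → F) : Prop where
  isOpen : IsOpen U
  contDiffOn : ContDiffOn ℝ ∞ r U
  mapsTo : Set.MapsTo r U M
  mapsTo_self : Set.MapsTo r U U
  fixed : ∀ y ∈ M, y ∈ U → r y = y

/-- Points of `M` in `U` are fixed, so cutting `U` down to `U ∩ r ⁻¹' U` yields a domain that `r`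
preserves. -/
theorem IsRetraction.of_nhds {M U : Set F} {r : F → F} (hU : IsOpen U)
    (hr : ContDiffOn ℝ ∞ r U) (hm : Set.MapsTo r U M) (hf : ∀ y ∈ M, y ∈ U → r y = y)
    {x : F} (hxM : x ∈ M) (hx : x ∈ U) : ∃ U', x ∈ U' ∧ IsRetraction M U' r := by
  refine ⟨U ∩ r ⁻¹' U, ⟨hx, by simpa [hf x hxM hx] using hx⟩, ?_, hr.mono Set.inter_subset_left,
    fun y hy => hm hy.1, fun y hy => ⟨hy.2, ?_⟩, fun y hy hy' => hf y hy hy'.1⟩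
  · exact hr.continuousOn.isOpen_inter_preimage hU hU
  · show r (r y) ∈ U
    rw [hf _ (hm hy.1) hy.2]; exact hy.2

section

variable {M U : Set F} {r : F → F} (h : IsRetraction M U r) {x : F} (hM : x ∈ M) (hx : x ∈ U)
include h

theorem IsRetraction.contDiffAt {y : F} (hy : y ∈ U) : ContDiffAt ℝ ∞ r y :=
  h.contDiffOn.contDiffAt (h.isOpen.mem_nhds hy)

theorem IsRetraction.hasFDerivAt {y : F} (hy : y ∈ U) : HasFDerivAt r (fderiv ℝ r y) y :=
  ((h.contDiffAt hy).differentiableAt (by simp)).hasFDerivAt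

theorem IsRetraction.eventually_mem {y : F} (hy : y ∈ U) : ∀ᶠ z in nhdsWithin y M, z ∈ M ∧ z ∈ U :=
  (eventually_mem_nhdsWithin).and (nhdsWithin_le_nhds (h.isOpen.mem_nhds hy))

include hM hx

theorem IsRetraction.hasFDerivWithinAt_id : HasFDerivWithinAt id (fderiv ℝ r x) M x := by
  refine (h.hasFDerivAt hx).hasFDerivWithinAt.congr_of_eventuallyEq ?_ (h.fixed x hM hx).symm
  filter_upwards [h.eventually_mem hx] with y hy
  exact (h.fixed y hy.1 hy.2).symm

/-- On `M` the retraction is the identity, and two derivatives within `M` of the same map agree on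
the tangent cone. -/
theorem IsRetraction.fderiv_apply {w : F} (hw : w ∈ tangentSpace M x) : fderiv ℝ r x w = w := by
  have := (h.hasFDerivWithinAt_id hM hx).unique_on (_root_.hasFDerivWithinAt_id x M)
  have h2 : tangentSpace M x ≤ LinearMap.eqLocus (fderiv ℝ r x).toLinearMap LinearMap.id :=
    Submodule.span_le.2 fun u hu => by simpa using this hu
  simpa using h2 hw

theorem IsRetraction.fderiv_mem (w : F) : fderiv ℝ r x w ∈ tangentSpace M x := by
  have h1 := (h.hasFDerivAt hx).hasFDerivWithinAt (s := U) |>.mapsTo_tangent_cone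
  have h2 : w ∈ tangentConeAt ℝ U x := by
    rw [tangentConeAt_of_mem_nhds (h.isOpen.mem_nhds hx)]; trivial
  have h3 := h1 h2
  rw [h.fixed x hM hx] at h3
  exact Submodule.subset_span (tangentConeAt_mono (h.mapsTo.image_subset) h3)

theorem IsRetraction.range_fderiv :
    LinearMap.range (fderiv ℝ r x).toLinearMap = tangentSpace M x := by
  ext w
  constructor
  · rintro ⟨u, rfl⟩; exact h.fderiv_mem hM hx u
  · intro hw; exact ⟨w, h.fderiv_apply hM hx hw⟩

end

/-! ### Derivatives within a set, on the tangent space -/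

/-- A derivative within `M` is not unique on the ambient space; its values on tangent vectors are,
and only these are used below. -/
theorem eqOn_tangentSpace {M : Set F} {x : F} {f : F → G} {f₁ f₂ : F →L[ℝ] G}
    (h₁ : HasFDerivWithinAt f f₁ M x) (h₂ : HasFDerivWithinAt f f₂ M x) {w : F}
    (hw : w ∈ tangentSpace M x) : f₁ w = f₂ w := by
  have h2 : tangentSpace M x ≤ LinearMap.eqLocus f₁.toLinearMap f₂.toLinearMap :=
    Submodule.span_le.2 fun u hu => by simpa using h₁.unique_on h₂ hu
  simpa using h2 hw

theorem fderivWithin_apply_eq {M : Set F} {x : F} {f : F → G} {f' : F →L[ℝ] G}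
    (h : HasFDerivWithinAt f f' M x) {w : F} (hw : w ∈ tangentSpace M x) :
    fderivWithin ℝ f M x w = f' w :=
  eqOn_tangentSpace h.differentiableWithinAt.hasFDerivWithinAt h hw

theorem mem_tangentSpace_of_hasFDerivWithinAt {M : Set F} {L : Set G} {x : F} {g : F → G}
    {g' : F →L[ℝ] G} (h : HasFDerivWithinAt g g' M x) (hm : Set.MapsTo g M L) {w : F}
    (hw : w ∈ tangentSpace M x) : g' w ∈ tangentSpace L (g x) := by
  have h2 : tangentSpace M x ≤ (tangentSpace L (g x)).comap g'.toLinearMap :=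
    Submodule.span_le.2 fun u hu => Submodule.subset_span
      (tangentConeAt_mono hm.image_subset (h.mapsTo_tangent_cone hu))
  exact h2 hw

/-- Any derivative within `M` may be precomposed with `Dr`, whose range is the tangent space, so its
values off that space can be prescribed freely. -/
theorem IsRetraction.hasFDerivWithinAt_congr {M U : Set F} {r : F → F} (h : IsRetraction M U r)
    {x : F} (hM : x ∈ M) (hx : x ∈ U) {f : F → G} {f₁ f₂ : F →L[ℝ] G}
    (hf : HasFDerivWithinAt f f₁ M x) (he : ∀ w ∈ tangentSpace M x, f₁ w = f₂ w) :
    HasFDerivWithinAt f f₂ M x := by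
  have hid := h.hasFDerivWithinAt_id hM hx
  have key : ∀ {f : F → G} {f' : F →L[ℝ] G}, HasFDerivWithinAt f f' M x →
      HasFDerivWithinAt f (f'.comp (fderiv ℝ r x)) M x := fun {f f'} hf =>
    HasFDerivWithinAt.comp (t := M) x (by simpa using hf) hid (Set.mapsTo_id M)
  have h1 := key hf
  have h2 : f₁.comp (fderiv ℝ r x) = f₂.comp (fderiv ℝ r x) := by
    ext w; exact he _ (h.fderiv_mem hM hx w)
  rw [h2] at h1
  -- Within `M`, the zero function also has derivative `f₂ - f₂ ∘ Dr`; adding it restores `f₂`.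
  have h3 := (f₂.hasFDerivWithinAt (s := M) (x := x)).sub (key (f₂.hasFDerivWithinAt))
  have h4 := h1.add h3
  simpa using h4

/-- Smooth functions on `M`, composed with a retraction, are smooth. -/
theorem IsRetraction.contDiffOn_comp {M U : Set F} {r : F → F} (h : IsRetraction M U r)
    {f : F → G} (hf : ContDiffOn ℝ ∞ f M) : ContDiffOn ℝ ∞ (fun y => f (r y)) U :=
  hf.comp h.contDiffOn h.mapsTo

end Retractions

section Charts

variable {F : Type*} [NormedAddCommGroup F] [NormedSpace ℝ F] [FiniteDimensional ℝ F]

/-- In a chart that straightens `M` to `V`, the retraction is a linear projection onto `V`. -/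
theorem IsSubmanifold.exists_retraction {k : ℕ} {M : Set F} (hM : IsSubmanifold k M) {x : F}
    (hx : x ∈ M) : ∃ U r, x ∈ U ∧ IsRetraction M U r ∧ Module.finrank ℝ (tangentSpace M x) = k := by
  obtain ⟨Φ, hxs, hΦ, hΨ, V, hV, hMV⟩ := hM x hx
  obtain ⟨p, hp⟩ := Submodule.ClosedComplemented.of_finiteDimensional V
  let π : F →L[ℝ] F := V.subtypeL.comp p
  have hπV : ∀ z, π z ∈ V := fun z => (p z).2
  have hπ : ∀ z ∈ V, π z = z := fun z hz => by simpa [π] using congrArg Subtype.val (hp ⟨z, hz⟩)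
  have hxV : Φ x ∈ V := (hMV x hxs).1 hx
  have hcont : ContinuousOn (fun y => π (Φ y)) Φ.source :=
    π.continuous.comp_continuousOn Φ.continuousOn
  have hUo : IsOpen (Φ.source ∩ (fun y => π (Φ y)) ⁻¹' Φ.target) :=
    hcont.isOpen_inter_preimage Φ.open_source Φ.open_target
  have hxU : x ∈ Φ.source ∩ (fun y => π (Φ y)) ⁻¹' Φ.target :=
    ⟨hxs, by simpa [hπ _ hxV] using Φ.map_source hxs⟩
  have hsm : ContDiffOn ℝ ∞ (fun y => Φ.symm (π (Φ y)))
      (Φ.source ∩ (fun y => π (Φ y)) ⁻¹' Φ.target) :=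
    hΨ.comp ((π.contDiff.comp_contDiffOn hΦ).mono Set.inter_subset_left) fun y hy => hy.2
  obtain ⟨U, hxU', hU⟩ := IsRetraction.of_nhds hUo hsm (M := M)
    (fun y hy => (hMV _ (Φ.map_target hy.2)).2 (by rw [Φ.right_inv hy.2]; exact hπV _))
    (fun y hy hy' => by rw [hπ _ ((hMV y hy'.1).1 hy), Φ.left_inv hy'.1]) hx hxU
  refine ⟨U, _, hxU', hU, ?_⟩
  have hA : HasFDerivAt Φ (fderiv ℝ Φ x) x :=
    ((hΦ.contDiffAt (Φ.open_source.mem_nhds hxs)).differentiableAt (by simp)).hasFDerivAt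
  have hB : HasFDerivAt Φ.symm (fderiv ℝ Φ.symm (Φ x)) (Φ x) :=
    ((hΨ.contDiffAt (Φ.open_target.mem_nhds (Φ.map_source hxs))).differentiableAt
      (by simp)).hasFDerivAt
  set A := fderiv ℝ Φ x
  set B := fderiv ℝ Φ.symm (Φ x)
  have hBA : B.comp A = ContinuousLinearMap.id ℝ F := by
    refine (hB.comp x hA).unique ((hasFDerivAt_id x).congr_of_eventuallyEq ?_)
    filter_upwards [Φ.open_source.mem_nhds hxs] with y hy
    simp [Φ.left_inv hy]
  have hAB : A.comp B = ContinuousLinearMap.id ℝ F := by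
    have hA' : HasFDerivAt Φ A (Φ.symm (Φ x)) := by rwa [Φ.left_inv hxs]
    refine (hA'.comp (Φ x) hB).unique ((hasFDerivAt_id (Φ x)).congr_of_eventuallyEq ?_)
    filter_upwards [Φ.open_target.mem_nhds (Φ.map_source hxs)] with y hy
    simp [Φ.right_inv hy]
  have hD : fderiv ℝ (fun y => Φ.symm (π (Φ y))) x = B.comp (π.comp A) := by
    have hB' : HasFDerivAt Φ.symm B (π (Φ x)) := by rwa [hπ _ hxV]
    exact (hB'.comp x (π.hasFDerivAt.comp x hA)).fderiv
  have hBA' : ∀ u, B (A u) = u := fun u => by simpa using congrArg (fun f => f u) hBA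
  have hAB' : ∀ u, A (B u) = u := fun u => by simpa using congrArg (fun f => f u) hAB
  have hT : tangentSpace M x = V.map B.toLinearMap := by
    rw [← hU.range_fderiv hx hxU', hD]
    ext w
    constructor
    · rintro ⟨u, rfl⟩; exact ⟨π (A u), hπV _, rfl⟩
    · rintro ⟨z, hz, rfl⟩; exact ⟨B z, by simp [hAB', hπ z hz]⟩
  rw [hT, ← hV]
  exact (Submodule.equivMapOfInjective B.toLinearMap
    (fun a b hab => by simpa [hAB'] using congrArg A hab) V).finrank_eq.symm

/-- With `Q = Dr` at `x`, the chart is `y ↦ Q (r y) + (1 - Q)(y - r y)`: the first term parametrizes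
`M` by its tangent space, the second measures the distance from `M`. Its derivative at `x` is `Q² +
(1 - Q)² = 1`. -/
theorem isSubmanifold_of_retraction {k : ℕ} {M : Set F}
    (h : ∀ x ∈ M, ∃ U r, x ∈ U ∧ IsRetraction M U r ∧ Module.finrank ℝ (tangentSpace M x) = k) :
    IsSubmanifold k M := by
  intro x hM
  obtain ⟨U, r, hx, hr, hk⟩ := h x hM
  set Q := fderiv ℝ r x with hQ
  let Φ : F → F := fun y => Q (r y) + ((y - r y) - Q (y - r y))
  have hΦ : ContDiffOn ℝ ∞ Φ U := by
    have h1 := hr.contDiffOn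
    have h2 : ContDiffOn ℝ ∞ (fun y => y - r y) U := contDiffOn_id.sub h1
    exact (Q.contDiff.comp_contDiffOn h1).add (h2.sub (Q.contDiff.comp_contDiffOn h2))
  have hQQ : ∀ w, Q (Q w) = Q w := fun w => hr.fderiv_apply hM hx (hr.fderiv_mem hM hx w)
  have hder : HasFDerivAt Φ ((ContinuousLinearEquiv.refl ℝ F : F ≃L[ℝ] F) : F →L[ℝ] F) x := by
    have h1 := hr.hasFDerivAt hx
    have h2 := (hasFDerivAt_id x).sub h1
    have h3 := (Q.hasFDerivAt.comp x h1).add (h2.sub (Q.hasFDerivAt.comp x h2))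
    refine h3.congr_fderiv ?_
    ext w
    simp [← hQ, hQQ]
  have hΦx : ContDiffAt ℝ ∞ Φ x := hΦ.contDiffAt (hr.isOpen.mem_nhds hx)
  let e₀ := hΦx.toOpenPartialHomeomorph Φ hder (by simp)
  have hxe : x ∈ e₀.source := hΦx.mem_toOpenPartialHomeomorph_source hder (by simp)
  have he₀ : ∀ y, e₀ y = Φ y := fun y => rfl
  -- the open set on which the chart is defined
  have hcont : ContinuousOn (fderiv ℝ Φ) U := (hΦ.fderiv_of_isOpen hr.isOpen (m := 0) (by simp)).continuousOn
  let W₁ := U ∩ (fderiv ℝ Φ) ⁻¹' (Set.range ((↑) : (F ≃L[ℝ] F) → (F →L[ℝ] F)))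
  have hW₁ : IsOpen W₁ := hcont.isOpen_inter_preimage hr.isOpen ContinuousLinearEquiv.isOpen
  -- `W₁` keeps `DΦ` invertible, so that the inverse is smooth on the whole target; the other factor
  -- keeps `r y` where `Φ` is injective.
  let W := W₁ ∩ (U ∩ r ⁻¹' e₀.source)
  have hW : IsOpen W := hW₁.inter
    (hr.contDiffOn.continuousOn.isOpen_inter_preimage hr.isOpen e₀.open_source)
  have hxW : x ∈ W := ⟨⟨hx, by rw [Set.mem_preimage, hder.fderiv]; exact ⟨_, rfl⟩⟩, hx, by
    rw [Set.mem_preimage, hr.fixed x hM hx]; exact hxe⟩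
  let e := e₀.restrOpen W hW
  have hes : e.source = e₀.source ∩ W := rfl
  refine ⟨e, ⟨hxe, hxW⟩, ?_, ?_, tangentSpace M x, hk, ?_⟩
  · exact hΦ.mono fun y hy => hy.2.1.1
  · intro z hz
    have hy : e.symm z ∈ e.source := e.map_target hz
    obtain ⟨A, hA⟩ := hy.2.1.2
    have hy' : ContDiffAt ℝ ∞ Φ (e.symm z) := hΦ.contDiffAt (hr.isOpen.mem_nhds hy.2.1.1)
    refine (e.contDiffAt_symm (f₀' := A) hz ?_ hy').contDiffWithinAt
    rw [hA]
    exact (hy'.differentiableAt (by simp)).hasFDerivAt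
  · intro y hy
    have hyU : y ∈ U := hy.2.1.1
    show y ∈ M ↔ Φ y ∈ _
    constructor
    · intro hyM
      simp only [Φ, hr.fixed y hyM hyU, sub_self, map_zero, add_zero]
      exact hr.fderiv_mem hM hx y
    · intro hT
      have h1 := hr.fderiv_apply hM hx hT
      -- Applying `Q` to `Φ y` removes the transverse part, so that part vanishes when `Φ y` is
      -- tangent. Then `Φ y = Φ (r y)`, and injectivity gives `y = r y`.
      have h2 : y - r y = Q (y - r y) := by
        simp only [Φ, map_add, map_sub, ← hQ, hQQ] at h1 ⊢
        have h1' := sub_eq_zero.2 h1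
        refine eq_of_sub_eq_zero (neg_eq_zero.1 ?_)
        rw [← h1']; abel
      have hry : r (r y) = r y := hr.fixed _ (hr.mapsTo hyU) (hr.mapsTo_self hyU)
      have h3 : Φ y = Φ (r y) := by
        simp only [Φ, hry, sub_self, map_zero, add_zero]
        rw [← h2]; simp
      have h4 : y = r y := e₀.injOn hy.1 hy.2.2.2 h3
      rw [h4]; exact hr.mapsTo hyU

end Charts

/-! ### The tangential projection and the second fundamental form -/

section Projection

variable {N : ℕ}

/-- Taking adjoints, as a real linear map. -/
def adjointMap (N : ℕ) : (E N →L[ℝ] E N) →L[ℝ] (E N →L[ℝ] E N) where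
  toFun := ContinuousLinearMap.adjoint
  map_add' := map_add _
  map_smul' c A := by simp
  cont := ContinuousLinearMap.adjoint.continuous

theorem inner_adjointMap (A : E N →L[ℝ] E N) (u w : E N) :
    ⟪adjointMap N A u, w⟫_ℝ = ⟪u, A w⟫_ℝ := A.adjoint_inner_left w u

/-- The orthogonal projection onto the range `T` of an idempotent `Q` is a smooth function of
`Q`. -/
theorem exists_equiv_starProjection {T : Submodule ℝ (E N)} {Q : E N →L[ℝ] E N}
    (hQ : ∀ w, Q w ∈ T) (hT : ∀ w ∈ T, Q w = w) :
    ∃ e : E N ≃L[ℝ] E N, (e : E N →L[ℝ] E N) = Q + adjointMap N Q - ContinuousLinearMap.id ℝ _ ∧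
      T.starProjection = Q.comp (ContinuousLinearMap.inverse
        (Q + adjointMap N Q - ContinuousLinearMap.id ℝ _)) := by
  set S := Q + adjointMap N Q - ContinuousLinearMap.id ℝ (E N) with hS
  set P := T.starProjection with hP
  have hPm : ∀ w, P w ∈ T := fun w => Submodule.starProjection_apply_mem T w
  have hPT : ∀ w ∈ T, P w = w := fun w hw => Submodule.starProjection_eq_self_iff.2 hw
  have hPsym : ∀ u w, ⟪P u, w⟫_ℝ = ⟪u, P w⟫_ℝ := fun u w =>
    Submodule.inner_starProjection_left_eq_right T u w
  -- `P Q = Q` as `Q` maps into `T`, and `P Q^* = P` is the adjoint of `Q P = P`. Hence `P (Q + Q^*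
  -- - 1) = Q`, and it remains to invert the second factor.
  have hPS : ∀ u, P (S u) = Q u := by
    intro u
    have h1 : P (adjointMap N Q u) = P u := by
      refine ext_inner_right ℝ fun w => ?_
      rw [hPsym, inner_adjointMap, hT _ (hPm w), hPsym]
    simp [hS, h1, hPT _ (hQ u)]
  have hinj : Function.Injective S.toLinearMap := by
    rw [← LinearMap.ker_eq_bot, LinearMap.ker_eq_bot']
    intro u hu
    have hu' : S u = 0 := hu
    have hQu : Q u = 0 := by rw [← hPS, hu', map_zero]
    have h2 : adjointMap N Q u = u := by
      have : S u = Q u + adjointMap N Q u - u := rfl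
      rw [hu', hQu, zero_add] at this
      exact (sub_eq_zero.1 this.symm)
    have h3 : ⟪u, u⟫_ℝ = 0 := by
      nth_rw 1 [← h2]
      rw [inner_adjointMap, hQu, inner_zero_right]
    exact inner_self_eq_zero.1 h3
  let e := (LinearEquiv.ofInjectiveEndo S.toLinearMap hinj).toContinuousLinearEquiv
  have he : (e : E N →L[ℝ] E N) = S := by ext1 u; rfl
  refine ⟨e, he, ?_⟩
  rw [← he, ContinuousLinearMap.inverse_equiv]
  ext1 u
  have := hPS (e.symm u)
  rw [← he] at this
  simpa using this

/-- The field of orthogonal projections onto the tangent spaces of `M`. -/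
def projField (M : Set (E N)) (y : E N) : E N →L[ℝ] E N := (tangentSpace M y).starProjection

theorem projField_mem (M : Set (E N)) (y w : E N) : projField M y w ∈ tangentSpace M y :=
  Submodule.starProjection_apply_mem _ w

theorem projField_eq_self {M : Set (E N)} {y w : E N} (hw : w ∈ tangentSpace M y) :
    projField M y w = w :=
  Submodule.starProjection_eq_self_iff.2 hw

theorem projField_eq_zero {M : Set (E N)} {y w : E N} (hw : w ∈ (tangentSpace M y)ᗮ) :
    projField M y w = 0 :=
  (Submodule.starProjection_apply_eq_zero_iff _).2 hw

theorem sub_projField_mem (M : Set (E N)) (y w : E N) :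
    w - projField M y w ∈ (tangentSpace M y)ᗮ :=
  Submodule.sub_starProjection_mem_orthogonal w

variable {k : ℕ} {M : Set (E N)} (hM : IsSubmanifold k M)
include hM

theorem IsSubmanifold.finrank_tangentSpace {x : E N} (hx : x ∈ M) :
    Module.finrank ℝ (tangentSpace M x) = k := by
  obtain ⟨U, r, -, -, h⟩ := hM.exists_retraction hx
  exact h

theorem IsSubmanifold.contDiffOn_projField : ContDiffOn ℝ ∞ (projField M) M := by
  intro x hx
  obtain ⟨U, r, hxU, hr, -⟩ := hM.exists_retraction hx
  have hD : ContDiffAt ℝ ∞ (fderiv ℝ r) x :=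
    (hr.contDiffOn.fderiv_of_isOpen hr.isOpen (m := ∞) (by simp)).contDiffAt
      (hr.isOpen.mem_nhds hxU)
  have hS : ContDiffAt ℝ ∞ (fun y => fderiv ℝ r y + adjointMap N (fderiv ℝ r y)
      - ContinuousLinearMap.id ℝ (E N)) x :=
    (hD.add ((adjointMap N).contDiff.contDiffAt.comp x hD)).sub contDiffAt_const
  obtain ⟨e, he, -⟩ := exists_equiv_starProjection (hr.fderiv_mem hx hxU)
    (fun w => hr.fderiv_apply hx hxU)
  have hI : ContDiffAt ℝ ∞ (fun y => ContinuousLinearMap.inverse (fderiv ℝ r y +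
      adjointMap N (fderiv ℝ r y) - ContinuousLinearMap.id ℝ (E N))) x := by
    refine ContDiffAt.comp x (g := ContinuousLinearMap.inverse) ?_ hS
    rw [← he]
    exact contDiffAt_map_inverse e
  refine ((hD.clm_comp hI).contDiffWithinAt (s := M)).congr_of_eventuallyEq_of_mem ?_ hx
  filter_upwards [hr.eventually_mem hxU] with y hy
  obtain ⟨-, -, h⟩ := exists_equiv_starProjection (hr.fderiv_mem hy.1 hy.2)
    (fun w => hr.fderiv_apply hy.1 hy.2)
  exact h

theorem IsSubmanifold.hasFDerivWithinAt_projField {x : E N} (hx : x ∈ M) :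
    HasFDerivWithinAt (projField M) (fderivWithin ℝ (projField M) M x) M x :=
  ((hM.contDiffOn_projField x hx).differentiableWithinAt (by simp)).hasFDerivWithinAt

/-- The derivative of a tangent vector field `W`, decomposed. -/
theorem IsSubmanifold.projDeriv_field {x : E N} (hx : x ∈ M) {W : E N → E N}
    {W' : E N →L[ℝ] E N} (hW : HasFDerivWithinAt W W' M x)
    (ht : ∀ᶠ y in nhdsWithin x M, W y ∈ tangentSpace M y) {v : E N} (hv : v ∈ tangentSpace M x) :
    fderivWithin ℝ (projField M) M x v (W x) = W' v - projField M x (W' v) := by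
  have h1 := (hM.hasFDerivWithinAt_projField hx).clm_apply hW
  have h2 : HasFDerivWithinAt (fun y => projField M y (W y)) W' M x := by
    refine hW.congr_of_eventuallyEq ?_ (projField_eq_self (ht.self_of_nhdsWithin hx))
    filter_upwards [ht] with y hy using projField_eq_self hy
  have h3 := eqOn_tangentSpace h1 h2 hv
  simp only [add_apply, ContinuousLinearMap.coe_comp, Function.comp_apply,
    ContinuousLinearMap.flip_apply] at h3
  exact eq_sub_of_add_eq' h3

theorem IsSubmanifold.hasFDerivWithinAt_tangentExtension {x : E N} (hx : x ∈ M) (w : E N) :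
    HasFDerivWithinAt (tangentExtension M w) ((fderivWithin ℝ (projField M) M x).flip w) M x := by
  have := (hM.hasFDerivWithinAt_projField hx).clm_apply (hasFDerivWithinAt_const w x M)
  exact this.congr_fderiv (by simp)

theorem IsSubmanifold.derivExtension_eq {x : E N} (hx : x ∈ M) {v : E N}
    (hv : v ∈ tangentSpace M x) (w : E N) :
    derivExtension M x v w = fderivWithin ℝ (projField M) M x v w :=
  fderivWithin_apply_eq (hM.hasFDerivWithinAt_tangentExtension hx w) hv

/-- Differentiating `P W = W` for `W = P w` shows that the derivative is normal at `x`: the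
extension of `w` has vanishing covariant derivative there, so no connection terms survive. -/
theorem IsSubmanifold.projField_projDeriv {x : E N} (hx : x ∈ M) {v w : E N}
    (hv : v ∈ tangentSpace M x) (hw : w ∈ tangentSpace M x) :
    projField M x (fderivWithin ℝ (projField M) M x v w) = 0 := by
  have h := hM.projDeriv_field hx (hM.hasFDerivWithinAt_tangentExtension hx w)
    (Filter.Eventually.of_forall fun y => projField_mem M y w) hv
  have h2 : tangentExtension M w x = w := projField_eq_self hw
  rw [h2, ContinuousLinearMap.flip_apply] at h
  exact sub_eq_self.1 h.symm

theorem IsSubmanifold.secondFundamentalForm_eq {x : E N} (hx : x ∈ M) {v w : E N}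
    (hv : v ∈ tangentSpace M x) (hw : w ∈ tangentSpace M x) :
    secondFundamentalForm M x v w = fderivWithin ℝ (projField M) M x v w := by
  rw [secondFundamentalForm, hM.derivExtension_eq hx hv, Submodule.starProjection_orthogonal_val]
  exact (congrArg _ (hM.projField_projDeriv hx hv hw)).trans (sub_zero _)

theorem IsSubmanifold.secondFundamentalForm_field {x : E N} (hx : x ∈ M) {W : E N → E N}
    {W' : E N →L[ℝ] E N} (hW : HasFDerivWithinAt W W' M x)
    (ht : ∀ᶠ y in nhdsWithin x M, W y ∈ tangentSpace M y) {v : E N} (hv : v ∈ tangentSpace M x) :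
    secondFundamentalForm M x v (W x) = W' v - projField M x (W' v) := by
  rw [hM.secondFundamentalForm_eq hx hv (ht.self_of_nhdsWithin hx), hM.projDeriv_field hx hW ht hv]

omit hM in
theorem secondFundamentalForm_mem (x v w : E N) :
    secondFundamentalForm M x v w ∈ (tangentSpace M x)ᗮ :=
  Submodule.starProjection_apply_mem _ _

/-- The tangent fields `y ↦ Dr_y w` express `II` as the normal part of the second derivative of `r`,
which is symmetric. -/
theorem IsSubmanifold.secondFundamentalForm_symm {x : E N} (hx : x ∈ M) {v w : E N}
    (hv : v ∈ tangentSpace M x) (hw : w ∈ tangentSpace M x) :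
    secondFundamentalForm M x v w = secondFundamentalForm M x w v := by
  obtain ⟨U, r, hxU, hr, -⟩ := hM.exists_retraction hx
  have hD : HasFDerivAt (fderiv ℝ r) (fderiv ℝ (fderiv ℝ r) x) x :=
    ((((hr.contDiffOn.fderiv_of_isOpen hr.isOpen (m := ∞) (by simp)).contDiffAt
      (hr.isOpen.mem_nhds hxU))).differentiableAt (by simp)).hasFDerivAt
  have key : ∀ {v w : E N}, v ∈ tangentSpace M x → w ∈ tangentSpace M x →
      secondFundamentalForm M x v w = fderiv ℝ (fderiv ℝ r) x v w -
        projField M x (fderiv ℝ (fderiv ℝ r) x v w) := by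
    intro v w hv hw
    have h1 := (hD.clm_apply (hasFDerivAt_const w x)).hasFDerivWithinAt (s := M)
    have h2 := hM.secondFundamentalForm_field hx h1 (by
      filter_upwards [hr.eventually_mem hxU] with y hy using hr.fderiv_mem hy.1 hy.2 w) hv
    rw [hr.fderiv_apply hx hxU hw] at h2
    simpa using h2
  have hs : IsSymmSndFDerivAt ℝ r x := (hr.contDiffAt hxU).isSymmSndFDerivAt
    (by simpa using (WithTop.coe_le_coe.2 le_top : ((2 : ℕ∞) : ℕ∞ω) ≤ ∞))
  rw [key hv hw, key hw hv, hs v w]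

/-- Bilinearity is packaged for changes of basis and for traces. -/
theorem IsSubmanifold.exists_bilinear_secondFundamentalForm {x : E N} (hx : x ∈ M) :
    ∃ B : tangentSpace M x →ₗ[ℝ] tangentSpace M x →ₗ[ℝ] E N,
      ∀ a w : tangentSpace M x, B a w = secondFundamentalForm M x a w :=
  ⟨LinearMap.mk₂ ℝ (fun a w => fderivWithin ℝ (projField M) M x a w) (fun a a' w => by simp)
    (fun c a w => by simp) (fun a w w' => by simp) (fun c a w => by simp),
    fun a w => (hM.secondFundamentalForm_eq hx a.2 w.2).symm⟩

/-! ### The covariant derivative -/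

theorem IsSubmanifold.covariantDerivative_eq_fderivWithin {x : E N} (hx : x ∈ M)
    (α : E N → (E N →L[ℝ] ℝ)) {v w : E N}
    (hv : v ∈ tangentSpace M x) (hw : w ∈ tangentSpace M x) :
    covariantDerivative M α x v w =
      fderivWithin ℝ (fun y => α y (projField M y w)) M x v := by
  rw [covariantDerivative, hM.derivExtension_eq hx hv]
  have : (tangentSpace M x).starProjection (fderivWithin ℝ (projField M) M x v w) = 0 :=
    hM.projField_projDeriv hx hv hw
  rw [this, map_zero, sub_zero]
  rfl

/-- The derivative of the extension of `w` is exactly the normal vector `II(v, w)`. The term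
`α(II(v, w))` offsets the arbitrary values of `α` on normal vectors. -/
theorem IsSubmanifold.covariantDerivative_eq {x : E N} (hx : x ∈ M)
    {α : E N → (E N →L[ℝ] ℝ)} {α' : E N →L[ℝ] E N →L[ℝ] ℝ} (hα : HasFDerivWithinAt α α' M x)
    {v w : E N} (hv : v ∈ tangentSpace M x) (hw : w ∈ tangentSpace M x) :
    covariantDerivative M α x v w = α' v w + α x (secondFundamentalForm M x v w) := by
  have h := hα.clm_apply (hM.hasFDerivWithinAt_tangentExtension hx w)
  have h2 : tangentExtension M w x = w := projField_eq_self hw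
  rw [hM.covariantDerivative_eq_fderivWithin hx α hv hw, hM.secondFundamentalForm_eq hx hv hw]
  refine (fderivWithin_apply_eq h hv).trans ?_
  simp [h2, add_comm]

theorem IsSubmanifold.covariantDerivative_congr {x : E N} (hx : x ∈ M)
    {α β : E N → (E N →L[ℝ] ℝ)}
    (h : ∀ᶠ y in nhdsWithin x M, ∀ w ∈ tangentSpace M y, α y w = β y w)
    {v w : E N} (hv : v ∈ tangentSpace M x) (hw : w ∈ tangentSpace M x) :
    covariantDerivative M α x v w = covariantDerivative M β x v w := by
  rw [hM.covariantDerivative_eq_fderivWithin hx α hv hw,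
    hM.covariantDerivative_eq_fderivWithin hx β hv hw]
  have h2 : (fun y => α y (projField M y w)) =ᶠ[nhdsWithin x M]
      (fun y => β y (projField M y w)) := by
    filter_upwards [h] with y hy using hy _ (projField_mem M y w)
  rw [h2.fderivWithin_eq (h2.self_of_nhdsWithin hx)]

/-- The derivative of an exact form is symmetric. -/
theorem IsSubmanifold.deriv_symm_of_isDifferentialOn {x : E N} (hx : x ∈ M) {f : E N → ℝ}
    {μ : E N → (E N →L[ℝ] ℝ)} (hf : IsDifferentialOn M f μ) {μ' : E N →L[ℝ] E N →L[ℝ] ℝ}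
    (hμ : HasFDerivWithinAt μ μ' M x) {v w : E N}
    (hv : v ∈ tangentSpace M x) (hw : w ∈ tangentSpace M x) : μ' v w = μ' w v := by
  obtain ⟨U, r, hxU, hr, -⟩ := hM.exists_retraction hx
  have h1 : ∀ᶠ y in nhds x, HasFDerivAt (fun z => f (r z)) ((μ (r y)).comp (fderiv ℝ r y)) y := by
    filter_upwards [hr.isOpen.mem_nhds hxU] with y hy
    have := (hf (r y) (hr.mapsTo hy)).comp y ((hr.hasFDerivAt hy).hasFDerivWithinAt (s := U))
      hr.mapsTo
    exact this.hasFDerivAt (hr.isOpen.mem_nhds hy)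
  have hD : HasFDerivAt (fderiv ℝ r) (fderiv ℝ (fderiv ℝ r) x) x :=
    ((((hr.contDiffOn.fderiv_of_isOpen hr.isOpen (m := ∞) (by simp)).contDiffAt
      (hr.isOpen.mem_nhds hxU))).differentiableAt (by simp)).hasFDerivAt
  have hμr : HasFDerivAt (fun y => μ (r y)) (μ'.comp (fderiv ℝ r x)) x := by
    have hμ2 : HasFDerivWithinAt μ μ' M (r x) := by rwa [hr.fixed x hx hxU]
    have := hμ2.comp x ((hr.hasFDerivAt hxU).hasFDerivWithinAt (s := U)) hr.mapsTo
    exact this.hasFDerivAt (hr.isOpen.mem_nhds hxU)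
  have h2 := second_derivative_symmetric_of_eventually h1 (hμr.clm_comp hD) v w
  have hs : IsSymmSndFDerivAt ℝ r x := (hr.contDiffAt hxU).isSymmSndFDerivAt
    (by simpa using (WithTop.coe_le_coe.2 le_top : ((2 : ℕ∞) : ℕ∞ω) ≤ ∞))
  have hvv := hr.fderiv_apply hx hxU hv
  have hww := hr.fderiv_apply hx hxU hw
  simp only [add_apply, ContinuousLinearMap.coe_comp, Function.comp_apply,
    ContinuousLinearMap.flip_apply, ContinuousLinearMap.compL_apply, hvv, hww, hs v w] at h2
  linarith

/-- The differential of `f` along `M`, extended by `0` to the normal vectors. -/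
def differentialForm (M : Set (E N)) (f : E N → ℝ) (y : E N) : E N →L[ℝ] ℝ :=
  (fderivWithin ℝ f M y).comp (projField M y)

/-- Near each point the form is `D(f ∘ r) ∘ P` on `M`. The factor `P` matters, since `fderivWithin`
alone is not controlled on normal vectors. -/
theorem IsSubmanifold.differentialForm_spec {f : E N → ℝ} (hf : ContDiffOn ℝ ∞ f M) :
    ContDiffOn ℝ ∞ (differentialForm M f) M ∧ IsDifferentialOn M f (differentialForm M f) := by
  constructor
  · intro x hx
    obtain ⟨U, r, hxU, hr, -⟩ := hM.exists_retraction hx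
    have hD : ContDiffAt ℝ ∞ (fderiv ℝ (fun z => f (r z))) x :=
      ((hr.contDiffOn_comp hf).fderiv_of_isOpen hr.isOpen (m := ∞) (by simp)).contDiffAt
        (hr.isOpen.mem_nhds hxU)
    refine (hD.contDiffWithinAt.clm_comp (hM.contDiffOn_projField x hx)).congr_of_eventuallyEq_of_mem
      ?_ hx
    filter_upwards [hr.eventually_mem hxU] with y hy
    ext1 w
    refine fderivWithin_apply_eq ?_ (projField_mem M y w)
    have h1 : HasFDerivWithinAt (fun z => f (r z)) (fderiv ℝ (fun z => f (r z)) y) M y :=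
      ((((hr.contDiffOn_comp hf).contDiffAt
        (hr.isOpen.mem_nhds hy.2))).differentiableAt (by simp)).hasFDerivAt.hasFDerivWithinAt
    refine h1.congr_of_eventuallyEq ?_ (by rw [hr.fixed y hy.1 hy.2])
    filter_upwards [hr.eventually_mem hy.2] with z hz
    rw [hr.fixed z hz.1 hz.2]
  · intro x hx
    obtain ⟨U, r, hxU, hr, -⟩ := hM.exists_retraction hx
    refine hr.hasFDerivWithinAt_congr hx hxU
      ((hf x hx).differentiableWithinAt (by simp)).hasFDerivWithinAt fun w hw => ?_
    simp [differentialForm, projField_eq_self hw]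

theorem IsSubmanifold.covariantDerivative_fderivWithin {x : E N} (hx : x ∈ M) {f : E N → ℝ}
    {μ : E N → (E N →L[ℝ] ℝ)} (hf : ∀ y ∈ M, ∀ w ∈ tangentSpace M y, fderivWithin ℝ f M y w = μ y w)
    {v w : E N} (hv : v ∈ tangentSpace M x) (hw : w ∈ tangentSpace M x) :
    covariantDerivative M (fun y => fderivWithin ℝ f M y) x v w = covariantDerivative M μ x v w := by
  refine hM.covariantDerivative_congr hx ?_ hv hw
  filter_upwards [self_mem_nhdsWithin] with y hy using hf y hy

end Projection

/-- Both sums are the image of the canonical tensor `∑ eᵢ ⊗ eᵢ`, which does not depend on the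
orthonormal basis. -/
theorem sum_orthonormalBasis_eq {V G ι κ : Type*} [NormedAddCommGroup V] [InnerProductSpace ℝ V]
    [FiniteDimensional ℝ V] [AddCommGroup G] [Module ℝ G] [Fintype ι] [Fintype κ]
    (B : V →ₗ[ℝ] V →ₗ[ℝ] G) (b : OrthonormalBasis ι ℝ V) (c : OrthonormalBasis κ ℝ V) :
    ∑ i, B (b i) (b i) = ∑ i, B (c i) (c i) := by
  have hb := InnerProductSpace.canonicalCovariantTensor_eq_sum V b
  rw [InnerProductSpace.canonicalCovariantTensor_eq_sum V c] at hb
  simpa using (congrArg (TensorProduct.lift B) hb).symm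

/-! ### The tangent spaces of a twisted conormal bundle -/

section Conormal

variable {N k : ℕ}

theorem mem_twistedConormal_iff {M : Set (E N)} {μ : E N → (E N →L[ℝ] ℝ)} {p : CotangentBundle N} :
    p ∈ twistedConormal M μ ↔ p.1 ∈ M ∧ ∀ w ∈ tangentSpace M p.1, p.2 w = μ p.1 w := by
  constructor
  · rintro ⟨h, ξ, hξ, hp⟩
    exact ⟨h, fun w hw => by rw [hp, add_apply, hξ w hw, zero_add]⟩
  · rintro ⟨h, hp⟩
    exact ⟨h, p.2 - μ p.1, fun w hw => by rw [sub_apply, hp w hw, sub_self], by abel⟩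

variable {M : Set (E N)} (hM : IsSubmanifold k M) {μ : E N → (E N →L[ℝ] ℝ)}

/-- A bilinear form whose restriction to the tangent space is `∇μ - ζ ∘ II`. -/
def twistedForm (M : Set (E N)) (μ : E N → (E N →L[ℝ] ℝ)) (p : CotangentBundle N) :
    E N →L[ℝ] E N →L[ℝ] ℝ :=
  fderivWithin ℝ μ M p.1 -
    (ContinuousLinearMap.compL ℝ (E N) (E N) ℝ (p.2 - μ p.1)).comp
      (fderivWithin ℝ (projField M) M p.1)

theorem twistedForm_apply (p : CotangentBundle N) (a w : E N) :
    twistedForm M μ p a w = fderivWithin ℝ μ M p.1 a w -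
      (p.2 - μ p.1) (fderivWithin ℝ (projField M) M p.1 a w) := rfl

theorem tangentSpace_univ {F : Type*} [NormedAddCommGroup F] [NormedSpace ℝ F] (x : F) :
    tangentSpace Set.univ x = ⊤ := by
  rw [tangentSpace, tangentConeAt_univ, Submodule.span_univ]

include hM

theorem IsSubmanifold.twistedForm_eq (hμ : ContDiffOn ℝ ∞ μ M) {p : CotangentBundle N}
    (hp : p.1 ∈ M) {a w : E N} (ha : a ∈ tangentSpace M p.1) (hw : w ∈ tangentSpace M p.1) :
    twistedForm M μ p a w =
      covariantDerivative M μ p.1 a w - p.2 (secondFundamentalForm M p.1 a w) := by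
  have hμ' := ((hμ p.1 hp).differentiableWithinAt (by simp)).hasFDerivWithinAt
  rw [twistedForm_apply, hM.covariantDerivative_eq hp hμ' ha hw,
    hM.secondFundamentalForm_eq hp ha hw, sub_apply]
  ring

/-- Necessity comes from differentiating the equation `(ζ - μ) ∘ P = 0` of the bundle. For
sufficiency, a vector is split into the velocity of a lift of `M` through `p` and that of a line in
the conormal fibre. -/
theorem IsSubmanifold.mem_tangentSpace_twistedConormal (hμ : ContDiffOn ℝ ∞ μ M)
    {p : CotangentBundle N} (hp : p ∈ twistedConormal M μ) (q : CotangentBundle N) :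
    q ∈ tangentSpace (twistedConormal M μ) p ↔ q.1 ∈ tangentSpace M p.1 ∧
      ∀ w ∈ tangentSpace M p.1, q.2 w = twistedForm M μ p q.1 w := by
  obtain ⟨hx, hζ⟩ := mem_twistedConormal_iff.1 hp
  have hμ' := ((hμ p.1 hx).differentiableWithinAt (by simp)).hasFDerivWithinAt
  have hP' := hM.hasFDerivWithinAt_projField hx
  have hfst : Set.MapsTo Prod.fst (twistedConormal M μ) M := fun q hq => hq.1
  constructor
  · intro hq
    have hq1 : q.1 ∈ tangentSpace M p.1 :=
      mem_tangentSpace_of_hasFDerivWithinAt (hasFDerivAt_fst.hasFDerivWithinAt) hfst hq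
    refine ⟨hq1, fun w hw => ?_⟩
    have h1 := (hasFDerivAt_snd (𝕜 := ℝ) (p := p)).hasFDerivWithinAt.sub
      (hμ'.comp p (hasFDerivAt_fst.hasFDerivWithinAt) hfst)
    have h2 := h1.clm_comp (hP'.comp p (hasFDerivAt_fst.hasFDerivWithinAt) hfst)
    have h3 : HasFDerivWithinAt (fun q : CotangentBundle N => (q.2 - μ q.1).comp (projField M q.1))
        (0 : CotangentBundle N →L[ℝ] (E N →L[ℝ] ℝ)) (twistedConormal M μ) p := by
      have hz : ∀ q ∈ twistedConormal M μ, (q.2 - μ q.1).comp (projField M q.1) = 0 := by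
        intro q hq
        ext1 w
        have := (mem_twistedConormal_iff.1 hq).2 _ (projField_mem M q.1 w)
        simp [this]
      exact (hasFDerivWithinAt_const 0 p _).congr hz (hz p hp)
    have h4 := congrArg (fun f => f w) (eqOn_tangentSpace h2 h3 hq)
    simp only [add_apply, ContinuousLinearMap.coe_comp, Function.comp_apply, sub_apply,
      ContinuousLinearMap.flip_apply, ContinuousLinearMap.compL_apply, Pi.sub_apply, zero_apply,
      ContinuousLinearMap.coe_fst', ContinuousLinearMap.coe_snd', projField_eq_self hw] at h4
    rw [twistedForm_apply, sub_apply]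
    linarith
  · rintro ⟨ha, hβ⟩
    obtain ⟨a, β⟩ := q
    simp only at ha hβ
    set η := p.2 - μ p.1 with hη
    have hηT : ∀ w ∈ tangentSpace M p.1, η w = 0 := fun w hw => by simp [hη, hζ w hw]
    have h1 : HasFDerivWithinAt (fun y => (y, η - η.comp (projField M y) + μ y))
        (((ContinuousLinearMap.id ℝ (E N)).prod (0 - (ContinuousLinearMap.compL ℝ (E N) (E N) ℝ η).comp
          (fderivWithin ℝ (projField M) M p.1) + fderivWithin ℝ μ M p.1))) M p.1 :=
      (hasFDerivWithinAt_id p.1 M).prodMk (((hasFDerivWithinAt_const η p.1 M).sub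
        ((ContinuousLinearMap.compL ℝ (E N) (E N) ℝ η).hasFDerivAt.comp_hasFDerivWithinAt p.1
          hP')).add hμ')
    have hm1 : Set.MapsTo (fun y => (y, η - η.comp (projField M y) + μ y)) M
        (twistedConormal M μ) := fun y hy => mem_twistedConormal_iff.2
      ⟨hy, fun w hw => by simp [projField_eq_self hw]⟩
    have h2 := mem_tangentSpace_of_hasFDerivWithinAt h1 hm1 ha
    have hpx : (p.1, η - η.comp (projField M p.1) + μ p.1) = p := by
      refine Prod.ext rfl ?_
      have : η.comp (projField M p.1) = 0 := by
        ext1 w; exact hηT _ (projField_mem M p.1 w)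
      show η - η.comp (projField M p.1) + μ p.1 = p.2
      rw [this, hη]
      abel
    rw [hpx] at h2
    set β₁ := -(η.comp (fderivWithin ℝ (projField M) M p.1 a)) + fderivWithin ℝ μ M p.1 a with hβ₁
    have h2' : (a, β₁) ∈ tangentSpace (twistedConormal M μ) p := by
      convert h2 using 1
      refine Prod.ext rfl ?_
      ext1 w
      simp [hβ₁]
    have hδ : ∀ w ∈ tangentSpace M p.1, (β - β₁) w = 0 := fun w hw => by
      rw [sub_apply, hβ w hw, twistedForm_apply, hβ₁]
      simp [hη]
      ring
    have h3 : HasFDerivWithinAt (fun s : ℝ => (p.1, p.2 + s • (β - β₁)))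
        ((0 : ℝ →L[ℝ] E N).prod ((ContinuousLinearMap.id ℝ ℝ).smulRight (β - β₁)))
        Set.univ 0 :=
      (hasFDerivWithinAt_const _ _ _).prodMk
        (((ContinuousLinearMap.id ℝ ℝ).smulRight (β - β₁)).hasFDerivWithinAt.const_add p.2)
    have hm3 : Set.MapsTo (fun s : ℝ => (p.1, p.2 + s • (β - β₁))) Set.univ
        (twistedConormal M μ) := fun s _ => mem_twistedConormal_iff.2
      ⟨hx, fun w hw => by
        have := hδ w hw
        simp only [sub_apply] at this
        simp [hζ w hw, this]⟩
    have h4 := mem_tangentSpace_of_hasFDerivWithinAt h3 hm3 (w := 1)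
      (by rw [tangentSpace_univ]; trivial)
    have hp0 : (p.1, p.2 + (0 : ℝ) • (β - β₁)) = p := by simp
    rw [hp0] at h4
    have h5 := add_mem h2' h4
    convert h5 using 1
    refine Prod.ext (add_zero a).symm ?_
    show β = β₁ + (1 : ℝ) • (β - β₁)
    rw [one_smul, add_sub_cancel]

/-- The map `J` identifies `ℝ^N = T ⊕ T^⊥` with the tangent space: the part in `T` is lifted by
`twistedForm`, and the normal part becomes a conormal covector. -/
theorem IsSubmanifold.finrank_tangentSpace_twistedConormal (hμ : ContDiffOn ℝ ∞ μ M)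
    {p : CotangentBundle N} (hp : p ∈ twistedConormal M μ) :
    Module.finrank ℝ (tangentSpace (twistedConormal M μ) p) = N := by
  set K := twistedForm M μ p with hK
  set P := projField M p.1 with hP
  let J : E N →ₗ[ℝ] CotangentBundle N :=
    { toFun := fun u => (P u, (K (P u)).comp P + innerSL ℝ (u - P u))
      map_add' := fun u w => by
        refine Prod.ext (map_add P u w) ?_
        ext1 z
        simp
        ring
      map_smul' := fun c u => by
        refine Prod.ext (map_smul P c u) ?_
        ext1 z
        simp
        ring }
  have hJ : ∀ u, J u = (P u, (K (P u)).comp P + innerSL ℝ (u - P u)) := fun u => rfl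
  have hPmem : ∀ u, P u ∈ tangentSpace M p.1 := projField_mem M p.1
  have hPself : ∀ u ∈ tangentSpace M p.1, P u = u := fun u hu => projField_eq_self hu
  have hinj : Function.Injective J := by
    rw [← LinearMap.ker_eq_bot, LinearMap.ker_eq_bot']
    intro u hu
    rw [hJ, Prod.mk_eq_zero] at hu
    have h1 := hu.2
    rw [hu.1] at h1
    simpa using congrArg (fun f => f u) h1
  have hr : tangentSpace (twistedConormal M μ) p = LinearMap.range J := by
    ext q
    rw [hM.mem_tangentSpace_twistedConormal hμ hp]
    constructor
    · rintro ⟨hq, hβ⟩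
      set δ := q.2 - (K q.1).comp P with hδ
      set z := (InnerProductSpace.toDual ℝ (E N)).symm δ with hz
      have hzi : ∀ w, ⟪z, w⟫_ℝ = δ w := fun w => InnerProductSpace.toDual_symm_apply
      have hzT : z ∈ (tangentSpace M p.1)ᗮ := by
        rw [Submodule.mem_orthogonal']
        intro w hw
        rw [hzi, hδ, sub_apply, hβ w hw]
        simp [hPself w hw, ← hK]
      have hPz : P z = 0 := projField_eq_zero hzT
      refine ⟨q.1 + z, ?_⟩
      show J (q.1 + z) = q
      have hP1 : P (q.1 + z) = q.1 := by rw [map_add, hPz, hPself _ hq, add_zero]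
      rw [hJ, hP1]
      refine Prod.ext rfl ?_
      ext1 w
      simp [hzi, hδ]
    · rintro ⟨u, rfl⟩
      show (J u).1 ∈ _ ∧ ∀ w ∈ tangentSpace M p.1, (J u).2 w = K (J u).1 w
      rw [hJ]
      refine ⟨hPmem u, fun w hw => ?_⟩
      have : ⟪u - P u, w⟫_ℝ = 0 :=
        (Submodule.mem_orthogonal' _ _).1 (sub_projField_mem M p.1 u) w hw
      simp only [add_apply, ContinuousLinearMap.coe_comp, Function.comp_apply, hPself w hw,
        innerSL_apply_apply, this, add_zero]
  rw [hr, LinearMap.finrank_range_of_inj hinj]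
  simp

/-- The retraction moves the base point by `r` and then subtracts from `η = ζ - μ` the part `η ∘ Dr`
seen by tangent vectors. -/
theorem IsSubmanifold.isSubmanifold_twistedConormal (hμ : ContDiffOn ℝ ∞ μ M) :
    IsSubmanifold N (twistedConormal M μ) := by
  refine isSubmanifold_of_retraction fun p hp => ?_
  have hx : p.1 ∈ M := hp.1
  obtain ⟨U, r, hxU, hr, -⟩ := hM.exists_retraction hx
  have hrs : ContDiffOn ℝ ∞ (fun q : CotangentBundle N => r q.1) (Prod.fst ⁻¹' U) :=
    hr.contDiffOn.comp contDiff_fst.contDiffOn fun q hq => hq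
  have hD : ContDiffOn ℝ ∞ (fun q : CotangentBundle N => fderiv ℝ r (r q.1)) (Prod.fst ⁻¹' U) :=
    (hr.contDiffOn.fderiv_of_isOpen hr.isOpen (m := ∞) (by simp)).comp hrs
      fun q hq => hr.mapsTo_self hq
  have hμs : ContDiffOn ℝ ∞ (fun q : CotangentBundle N => μ (r q.1)) (Prod.fst ⁻¹' U) :=
    hμ.comp hrs fun q hq => hr.mapsTo hq
  have hsub : ContDiffOn ℝ ∞ (fun q : CotangentBundle N => q.2 - μ (r q.1)) (Prod.fst ⁻¹' U) :=
    contDiff_snd.contDiffOn.sub hμs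
  obtain ⟨U', hU', hR⟩ := IsRetraction.of_nhds (M := twistedConormal M μ)
    (hr.isOpen.preimage continuous_fst)
    (hrs.prodMk ((hsub.sub (hsub.clm_comp hD)).add hμs))
    (fun q hq => mem_twistedConormal_iff.2 ⟨hr.mapsTo hq, fun w hw => by
      have := hr.fderiv_apply (hr.mapsTo hq) (hr.mapsTo_self hq) hw
      simp [this]⟩)
    (fun q hq hqU => by
      obtain ⟨h1, h2⟩ := mem_twistedConormal_iff.1 hq
      have h3 : r q.1 = q.1 := hr.fixed q.1 h1 hqU
      refine Prod.ext h3 ?_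
      ext1 w
      have := h2 _ (hr.fderiv_mem h1 hqU w)
      simp [h3, this]) hp hxU
  exact ⟨U', _, hU', hR, hM.finrank_tangentSpace_twistedConormal hμ hp⟩

end Conormal

/-! ### The phase of a twisted conormal bundle -/

section Phase

variable {N k : ℕ}

/-- Orthonormal bases of a subspace and of its orthogonal complement, put together. -/
theorem exists_adapted_orthonormalBasis {T : Submodule ℝ (E N)} (t : OrthonormalBasis (Fin k) ℝ T) :
    ∃ (j : ℕ) (e : OrthonormalBasis (Fin k ⊕ Fin j) ℝ (E N)), k + j = N ∧
      (∀ i, e (Sum.inl i) = t i) ∧ ∀ i, e (Sum.inr i) ∈ Tᗮ := by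
  let u := stdOrthonormalBasis ℝ Tᗮ
  set j := Module.finrank ℝ Tᗮ with hj
  have hk : Module.finrank ℝ T = k := by
    rw [Module.finrank_eq_card_basis t.toBasis, Fintype.card_fin]
  have hkj : k + j = N := by
    rw [← hk, hj, Submodule.finrank_add_finrank_orthogonal]; simp
  let f : Fin k ⊕ Fin j → E N := Sum.elim (fun i => (t i : E N)) (fun i => (u i : E N))
  have hf : Orthonormal ℝ f := by
    rw [orthonormal_iff_ite]
    have ht := orthonormal_iff_ite.1 t.orthonormal
    have hu := orthonormal_iff_ite.1 u.orthonormal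
    rintro (a | a) (b | b)
    · simpa [f] using ht a b
    · simpa [f] using (Submodule.mem_orthogonal T _).1 (u b).2 _ (t a).2
    · simpa [f] using (Submodule.mem_orthogonal' T _).1 (u a).2 _ (t b).2
    · simpa [f] using hu a b
  have hc : Fintype.card (Fin k ⊕ Fin j) = Module.finrank ℝ (E N) := by simp [hkj]
  let b := basisOfLinearIndependentOfCardEqFinrank' f hf.linearIndependent hc
  have hb : (b : Fin k ⊕ Fin j → E N) = f := coe_basisOfLinearIndependentOfCardEqFinrank' ..
  have hbf : Orthonormal ℝ b := by rw [hb]; exact hf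
  refine ⟨j, b.toOrthonormalBasis hbf, hkj, fun i => ?_, fun i => ?_⟩
  · rw [Module.Basis.coe_toOrthonormalBasis, hb]; rfl
  · rw [Module.Basis.coe_toOrthonormalBasis, hb]; exact (u i).2

theorem exists_orthonormalBasis_of_orthonormal {T : Submodule ℝ (E N)}
    (hT : Module.finrank ℝ T = k) {t : Fin k → E N} (ho : Orthonormal ℝ t) (hm : ∀ i, t i ∈ T) :
    ∃ b : OrthonormalBasis (Fin k) ℝ T, ∀ i, (b i : E N) = t i := by
  let f : Fin k → T := fun i => ⟨t i, hm i⟩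
  have hf : Orthonormal ℝ f := by
    rw [orthonormal_iff_ite] at ho ⊢
    intro a b; exact ho a b
  have hc : Fintype.card (Fin k) = Module.finrank ℝ T := by rw [hT, Fintype.card_fin]
  let b := basisOfLinearIndependentOfCardEqFinrank' f hf.linearIndependent hc
  have hb : (b : Fin k → T) = f := coe_basisOfLinearIndependentOfCardEqFinrank' ..
  have hbf : Orthonormal ℝ b := by rw [hb]; exact hf
  exact ⟨b.toOrthonormalBasis hbf, fun i => by rw [Module.Basis.coe_toOrthonormalBasis, hb]⟩

/-- Each of the `j` conormal directions contributes a factor `i` to the volume form and `π/2` to `θ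
- φ`; together they leave only a real sign. -/
theorem exp_cophase {j : ℕ} (h : k + j = N) (θ : ℝ) :
    Complex.exp (θ * Complex.I) * Complex.I ^ j =
      ((-1 : ℝ) ^ j : ℝ) * Complex.exp (cophase N k θ * Complex.I) := by
  have hI : Complex.exp ((j : ℂ) * (Real.pi / 2 * Complex.I)) = Complex.I ^ j := by
    rw [Complex.exp_nat_mul, Complex.exp_pi_div_two_mul_I]
  have h1 : (θ : ℂ) * Complex.I =
      cophase N k θ * Complex.I + (j : ℂ) * (Real.pi / 2 * Complex.I) := by
    subst h
    simp only [cophase]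
    push_cast
    ring
  rw [h1, Complex.exp_add, hI, mul_assoc, ← mul_pow, Complex.I_mul_I]
  push_cast
  ring

/-- The holomorphic volume form on the graph-like subspace attached to a bilinear form `K` on `T`. -/
theorem holomorphicVolume_im_eq_zero_iff {T : Submodule ℝ (E N)} (t : OrthonormalBasis (Fin k) ℝ T)
    (K : E N →L[ℝ] E N →L[ℝ] ℝ) (θ : ℝ) :
    (∀ w : Fin N → CotangentBundle N,
      (∀ j, (w j).1 ∈ T ∧ ∀ u ∈ T, (w j).2 u = K (w j).1 u) →
        (Complex.exp (θ * Complex.I) * holomorphicVolume w).im = 0) ↔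
    (Complex.exp (cophase N k θ * Complex.I) *
      (1 + Complex.I • Matrix.of fun i j : Fin k => ((K (t i) (t j) : ℝ) : ℂ)).det).im = 0 := by
  obtain ⟨j, e, hkj, het, hen⟩ := exists_adapted_orthonormalBasis t
  have hσ : Nonempty (Fin N ≃ Fin k ⊕ Fin j) :=
    ⟨Fintype.equivOfCardEq (by simp [hkj])⟩
  obtain ⟨σ⟩ := hσ
  set C := Matrix.of fun i j : Fin k => ((K (t i) (t j) : ℝ) : ℂ) with hC
  -- In the adapted basis, the graph over `T` gives the rows of `1 + iC`, and the conormal covectors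
  -- give the rows of `i`.
  set D : Matrix (Fin k ⊕ Fin j) (Fin k ⊕ Fin j) ℂ :=
    Matrix.fromBlocks (1 + Complex.I • C) 0 0 (Complex.I • 1) with hD
  have hdetD : D.det = (1 + Complex.I • C).det * Complex.I ^ j := by
    rw [hD, Matrix.det_fromBlocks_zero₁₂, Matrix.det_smul]; simp
  -- the matrix of the adapted basis
  let U : Matrix (Fin N) (Fin N) ℝ := Matrix.of fun m l => e (σ l) m
  have hU : U.det ≠ 0 := by
    have h1 : U.transpose * U = 1 := by
      ext a b
      have := orthonormal_iff_ite.1 e.orthonormal (σ a) (σ b)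
      simp only [σ.apply_eq_iff_eq, PiLp.inner_apply] at this
      simp only [Matrix.mul_apply, Matrix.transpose_apply, U, Matrix.of_apply, Matrix.one_apply]
      rw [← this]
      simp [mul_comm]
    intro h0
    have := congrArg Matrix.det h1
    simp [h0] at this
  let R : (Fin N → CotangentBundle N) → Matrix (Fin N) (Fin N) ℝ := fun w => Matrix.of fun i l =>
    Sum.elim (fun a => ⟪(w i).1, e (Sum.inl a)⟫_ℝ) (fun a => (w i).2 (e (Sum.inr a))) (σ l)
  -- Every `w` is a real combination, with coefficients `R w`, of one standard frame with matrix
  -- `D`. Hence all values of the volume form are real multiples of a single complex number.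
  have hfac : ∀ w : Fin N → CotangentBundle N,
      (∀ j, (w j).1 ∈ T ∧ ∀ u ∈ T, (w j).2 u = K (w j).1 u) →
      holomorphicVolume w * (U.det : ℂ) = (R w).det * D.det := by
    intro w hw
    have h1 : (U.det : ℂ) = (U.map Complex.ofReal).det := RingHom.map_det Complex.ofRealHom U
    have h2 : ((R w).det : ℂ) = ((R w).map Complex.ofReal).det :=
      RingHom.map_det Complex.ofRealHom (R w)
    rw [holomorphicVolume, h1, h2, ← Matrix.det_submatrix_equiv_self σ D, ← Matrix.det_mul,
      ← Matrix.det_mul]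
    congr 1
    ext i l
    obtain ⟨hwT, hwK⟩ := hw i
    have hsum : ∀ x : E N, ∑ m, (w i).2 (EuclideanSpace.single m 1) * x m = (w i).2 x := by
      intro x
      conv_rhs => rw [← (EuclideanSpace.basisFun (Fin N) ℝ).sum_repr x]
      simp [mul_comm]
    have hlhs : ((Matrix.of fun j k : Fin N => (((w j).1 k : ℝ) : ℂ) +
        Complex.I * (((w j).2 (EuclideanSpace.single k 1) : ℝ) : ℂ)) * U.map Complex.ofReal) i l =
        ((⟪(w i).1, e (σ l)⟫_ℝ : ℝ) : ℂ) + Complex.I * (((w i).2 (e (σ l)) : ℝ) : ℂ) := by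
      rw [← hsum, PiLp.inner_apply]
      simp only [Matrix.mul_apply, Matrix.of_apply, Matrix.map_apply, U, add_mul,
        Finset.sum_add_distrib, Complex.ofReal_sum, Finset.mul_sum]
      congr 1
      · refine Finset.sum_congr rfl fun m _ => ?_
        simp [mul_comm]
      · refine Finset.sum_congr rfl fun m _ => ?_
        push_cast
        ring
    have hrhs : ((R w).map Complex.ofReal * D.submatrix σ σ) i l =
        ∑ m : Fin k ⊕ Fin j, ((Sum.elim (fun a => ⟪(w i).1, e (Sum.inl a)⟫_ℝ)
          (fun a => (w i).2 (e (Sum.inr a))) m : ℝ) : ℂ) * D m (σ l) := by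
      rw [← σ.sum_comp]
      simp [Matrix.mul_apply, R]
    rw [hlhs, hrhs, Fintype.sum_sum_type]
    rcases σ l with a | a
    · have hexp : (w i).1 = ∑ m, ⟪(w i).1, e (Sum.inl m)⟫_ℝ • e (Sum.inl m) := by
        have := t.sum_repr' ⟨(w i).1, hwT⟩
        have := congrArg Subtype.val this
        simp only [Submodule.coe_sum, Submodule.coe_smul, Submodule.coe_inner] at this
        conv_lhs => rw [← this]
        refine Finset.sum_congr rfl fun m _ => ?_
        rw [het, real_inner_comm]
      have hK : K (w i).1 (e (Sum.inl a)) =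
          ∑ m, ⟪(w i).1, e (Sum.inl m)⟫_ℝ * K (e (Sum.inl m)) (e (Sum.inl a)) := by
        conv_lhs => rw [hexp]
        simp
      have heT : e (Sum.inl a) ∈ T := by rw [het]; exact (t a).2
      rw [hwK _ heT, hK]
      simp only [hD, Matrix.fromBlocks_apply₁₁, Matrix.fromBlocks_apply₂₁, Sum.elim_inl,
        Matrix.zero_apply, mul_zero, Finset.sum_const_zero, add_zero, Matrix.add_apply,
        Matrix.smul_apply, mul_add, Finset.sum_add_distrib, Matrix.one_apply]
      congr 1
      · simp
      · push_cast
        rw [Finset.mul_sum]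
        refine Finset.sum_congr rfl fun m _ => ?_
        simp only [hC, Matrix.of_apply, het, smul_eq_mul]
        ring
    · have h0 : ⟪(w i).1, e (Sum.inr a)⟫_ℝ = 0 := (Submodule.mem_orthogonal T _).1 (hen a) _ hwT
      rw [h0]
      simp [hD, Matrix.one_apply, mul_comm]
  have him : ∀ (c : ℝ) (z : ℂ), ((c : ℂ) * z).im = c * z.im := fun c z => Complex.im_ofReal_mul c z
  have hsgn : ((-1 : ℝ) ^ j) ≠ 0 := pow_ne_zero _ (by norm_num)
  have hphase : ∀ w : Fin N → CotangentBundle N,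
      (∀ j, (w j).1 ∈ T ∧ ∀ u ∈ T, (w j).2 u = K (w j).1 u) →
      U.det * (Complex.exp (θ * Complex.I) * holomorphicVolume w).im =
        (R w).det * (-1) ^ j * (Complex.exp (cophase N k θ * Complex.I) *
          (1 + Complex.I • C).det).im := by
    intro w hw
    rw [← him, ← him]
    congr 1
    calc (U.det : ℂ) * (Complex.exp (θ * Complex.I) * holomorphicVolume w)
        = Complex.exp (θ * Complex.I) * (holomorphicVolume w * (U.det : ℂ)) := by ring
      _ = (Complex.exp (θ * Complex.I) * Complex.I ^ j) * ((R w).det *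
            (1 + Complex.I • C).det) := by rw [hfac w hw, hdetD]; ring
      _ = _ := by rw [exp_cophase hkj]; push_cast; ring
  constructor
  · intro h
    -- The standard frame itself, for which `R w = 1`.
    let w : Fin N → CotangentBundle N := fun i => Sum.elim
      (fun a => (e (Sum.inl a), (K (e (Sum.inl a))).comp T.starProjection))
      (fun a => (0, innerSL ℝ (e (Sum.inr a)))) (σ i)
    have hw : ∀ j, (w j).1 ∈ T ∧ ∀ u ∈ T, (w j).2 u = K (w j).1 u := by
      intro i
      simp only [w]
      rcases σ i with a | a
      · refine ⟨by simp [het], fun u hu => ?_⟩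
        simp [Submodule.starProjection_eq_self_iff.2 hu]
      · refine ⟨by simp, fun u hu => ?_⟩
        simpa using (Submodule.mem_orthogonal' T _).1 (hen a) u hu
    have hR : R w = 1 := by
      ext i l
      have hee := orthonormal_iff_ite.1 e.orthonormal
      have hone : (1 : Matrix (Fin N) (Fin N) ℝ) i l = if σ i = σ l then 1 else 0 := by
        simp [Matrix.one_apply]
      rw [hone]
      simp only [R, w, Matrix.of_apply]
      rcases σ i with a | a <;> rcases σ l with b | b
      · simpa using hee (Sum.inl a) (Sum.inl b)
      · simp [(Submodule.starProjection_apply_eq_zero_iff _).2 (hen b)]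
      · simp
      · simpa using hee (Sum.inr a) (Sum.inr b)
    have := hphase w hw
    rw [h w hw, hR, Matrix.det_one, mul_zero, one_mul] at this
    exact (mul_eq_zero.1 this.symm).resolve_left hsgn
  · intro h w hw
    have := hphase w hw
    rw [h, mul_zero] at this
    exact (mul_eq_zero.1 this).resolve_left hU

/-- The twisted-austere equations. -/
theorem IsSubmanifold.isSpecialLagrangian_iff {M : Set (E N)} (hM : IsSubmanifold k M)
    {μ : E N → (E N →L[ℝ] ℝ)} (hμ : ContDiffOn ℝ ∞ μ M) (θ : ℝ)
    {t : E N → Fin k → E N}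
    (ht : ∀ x ∈ M, Orthonormal ℝ (t x) ∧ ∀ i, t x i ∈ tangentSpace M x) :
    IsSpecialLagrangian θ (twistedConormal M μ) ↔ ∀ x ∈ M,
      (∀ v ∈ tangentSpace M x, ∀ w ∈ tangentSpace M x,
        covariantDerivative M μ x v w = covariantDerivative M μ x w v) ∧
      ∀ ν ∈ (tangentSpace M x)ᗮ, (Complex.exp (cophase N k θ * Complex.I) *
        (1 + Complex.I • Matrix.of fun i j : Fin k =>
          ((covariantDerivative M μ x (t x i) (t x j) -
            ⟪ν, secondFundamentalForm M x (t x i) (t x j)⟫_ℝ : ℝ) : ℂ)).det).im = 0 := by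
  have hbasis : ∀ x ∈ M, ∃ b : OrthonormalBasis (Fin k) ℝ (tangentSpace M x),
      ∀ i, (b i : E N) = t x i := fun x hx =>
    exists_orthonormalBasis_of_orthonormal (hM.finrank_tangentSpace hx) (ht x hx).1 (ht x hx).2
  -- the condition at a single point of the bundle
  have hpt : ∀ p ∈ twistedConormal M μ, ∀ ν : E N,
      (∀ u ∈ (tangentSpace M p.1)ᗮ, p.2 u = ⟪ν, u⟫_ℝ) →
      (((∀ a ∈ tangentSpace (twistedConormal M μ) p, ∀ b ∈ tangentSpace (twistedConormal M μ) p,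
        canonicalSymplectic a b = 0) ∧
      ∀ w : Fin N → CotangentBundle N, (∀ j, w j ∈ tangentSpace (twistedConormal M μ) p) →
        (Complex.exp (θ * Complex.I) * holomorphicVolume w).im = 0) ↔
      (∀ v ∈ tangentSpace M p.1, ∀ w ∈ tangentSpace M p.1,
        covariantDerivative M μ p.1 v w = covariantDerivative M μ p.1 w v) ∧
      (Complex.exp (cophase N k θ * Complex.I) *
        (1 + Complex.I • Matrix.of fun i j : Fin k =>
          ((covariantDerivative M μ p.1 (t p.1 i) (t p.1 j) -
            ⟪ν, secondFundamentalForm M p.1 (t p.1 i) (t p.1 j)⟫_ℝ : ℝ) : ℂ)).det).im = 0) := by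
    intro p hp ν hν
    have hx : p.1 ∈ M := hp.1
    obtain ⟨b, hb⟩ := hbasis p.1 hx
    have hK : ∀ v ∈ tangentSpace M p.1, ∀ w ∈ tangentSpace M p.1, twistedForm M μ p v w =
        covariantDerivative M μ p.1 v w - ⟪ν, secondFundamentalForm M p.1 v w⟫_ℝ := by
      intro v hv w hw
      rw [hM.twistedForm_eq hμ hx hv hw, hν _ (secondFundamentalForm_mem _ _ _)]
    refine and_congr ?_ ?_
    · have hC : ∀ a ∈ tangentSpace (twistedConormal M μ) p,
          ∀ b ∈ tangentSpace (twistedConormal M μ) p, canonicalSymplectic a b =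
            covariantDerivative M μ p.1 b.1 a.1 - covariantDerivative M μ p.1 a.1 b.1 := by
        intro a ha b hb
        obtain ⟨ha1, ha2⟩ := (hM.mem_tangentSpace_twistedConormal hμ hp a).1 ha
        obtain ⟨hb1, hb2⟩ := (hM.mem_tangentSpace_twistedConormal hμ hp b).1 hb
        rw [canonicalSymplectic, hb2 _ ha1, ha2 _ hb1, hK _ hb1 _ ha1, hK _ ha1 _ hb1,
          hM.secondFundamentalForm_symm hx hb1 ha1]
        ring
      constructor
      · intro h v hv w hw
        have hlift : ∀ v ∈ tangentSpace M p.1,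
            (v, twistedForm M μ p v) ∈ tangentSpace (twistedConormal M μ) p := fun v hv =>
          (hM.mem_tangentSpace_twistedConormal hμ hp _).2 ⟨hv, fun _ _ => rfl⟩
        have h1 := hC _ (hlift w hw) _ (hlift v hv)
        rw [h _ (hlift w hw) _ (hlift v hv)] at h1
        exact sub_eq_zero.1 h1.symm
      · intro h a ha b hb
        rw [hC a ha b hb, h _ ((hM.mem_tangentSpace_twistedConormal hμ hp a).1 ha).1 _
          ((hM.mem_tangentSpace_twistedConormal hμ hp b).1 hb).1, sub_self]
    · have hKt : (Matrix.of fun i j : Fin k => ((twistedForm M μ p (b i) (b j) : ℝ) : ℂ)) =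
          Matrix.of fun i j : Fin k => ((covariantDerivative M μ p.1 (t p.1 i) (t p.1 j) -
            ⟪ν, secondFundamentalForm M p.1 (t p.1 i) (t p.1 j)⟫_ℝ : ℝ) : ℂ) := by
        ext i j
        simp only [Matrix.of_apply]
        rw [hK _ (b i).2 _ (b j).2, hb, hb]
      rw [← hKt, ← holomorphicVolume_im_eq_zero_iff b]
      simp only [hM.mem_tangentSpace_twistedConormal hμ hp]
  constructor
  · rintro ⟨-, h⟩ x hx
    -- Composing `μ` with the projection discards its values on normal vectors, so the normal part
    -- of the covector is exactly `ν`.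
    let p : E N → CotangentBundle N := fun ν => (x, (μ x).comp (projField M x) + innerSL ℝ ν)
    have hp : ∀ ν ∈ (tangentSpace M x)ᗮ, p ν ∈ twistedConormal M μ := fun ν hν =>
      mem_twistedConormal_iff.2 ⟨hx, fun w hw => by
        simp [p, projField_eq_self hw, (Submodule.mem_orthogonal' _ _).1 hν w hw]⟩
    have hpν : ∀ ν, ∀ u ∈ (tangentSpace M x)ᗮ, (p ν).2 u = ⟪ν, u⟫_ℝ := fun ν u hu => by
      simp [p, projField_eq_zero hu]
    exact ⟨((hpt _ (hp 0 (zero_mem _)) 0 (hpν 0)).1 (h _ (hp 0 (zero_mem _)))).1, fun ν hν =>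
      ((hpt _ (hp ν hν) ν (hpν ν)).1 (h _ (hp ν hν))).2⟩
  · intro h
    refine ⟨hM.isSubmanifold_twistedConormal hμ, fun p hp => ?_⟩
    set z := (InnerProductSpace.toDual ℝ (E N)).symm p.2 with hz
    have hzi : ∀ w, ⟪z, w⟫_ℝ = p.2 w := fun w => InnerProductSpace.toDual_symm_apply
    obtain ⟨h1, h2⟩ := h p.1 hp.1
    refine (hpt p hp (z - projField M p.1 z) fun u hu => ?_).2
      ⟨h1, h2 _ (sub_projField_mem M p.1 z)⟩
    rw [inner_sub_left, (Submodule.mem_orthogonal _ _).1 hu _ (projField_mem M p.1 z), sub_zero, hzi]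

/-- The function `Im (e^{iφ} det (1 + i c))` of a symmetric form `c` on a `3`-space, for `c` the sum
of `b` on a line and of `![![p, r], ![r', q]]` on the orthogonal plane. -/
def splitPhase (φ b p r r' q : ℝ) : ℝ :=
  Real.sin φ * (1 - b * (p + q) - (p * q - r * r')) +
    Real.cos φ * (b + (p + q) - b * (p * q - r * r'))

/-- The phase condition for a `3 × 3` matrix. -/
theorem phase_fin_three (φ : ℝ) (c : Fin 3 → Fin 3 → ℝ) (h01 : c 0 1 = 0) (h02 : c 0 2 = 0)
    (h10 : c 1 0 = 0) (h20 : c 2 0 = 0) :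
    (Complex.exp (φ * Complex.I) *
      (1 + Complex.I • Matrix.of fun i j : Fin 3 => ((c i j : ℝ) : ℂ)).det).im =
    splitPhase φ (c 0 0) (c 1 1) (c 1 2) (c 2 1) (c 2 2) := by
  rw [Matrix.det_fin_three, Complex.mul_im, Complex.exp_ofReal_mul_I_re,
    Complex.exp_ofReal_mul_I_im]
  simp [h01, h02, h10, h20, splitPhase]
  ring

end Phase

theorem IsSubmanifold.hasFDerivWithinAt_congr {F G : Type*} [NormedAddCommGroup F]
    [NormedSpace ℝ F] [FiniteDimensional ℝ F] [NormedAddCommGroup G] [NormedSpace ℝ G] {k : ℕ}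
    {M : Set F} (hM : IsSubmanifold k M) {x : F} (hx : x ∈ M) {f : F → G} {f₁ f₂ : F →L[ℝ] G}
    (hf : HasFDerivWithinAt f f₁ M x) (he : ∀ w ∈ tangentSpace M x, f₁ w = f₂ w) :
    HasFDerivWithinAt f f₂ M x := by
  obtain ⟨U, r, hxU, hr, -⟩ := hM.exists_retraction hx
  exact hr.hasFDerivWithinAt_congr hx hxU hf he

/-- A function with vanishing differential on a connected submanifold is constant. -/
theorem IsSubmanifold.eq_of_hasFDerivWithinAt_zero {F : Type*} [NormedAddCommGroup F]
    [NormedSpace ℝ F] [FiniteDimensional ℝ F] {k : ℕ} {M : Set F} (hM : IsSubmanifold k M)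
    (hc : IsPreconnected M) {f : F → ℝ} (hf : ∀ x ∈ M, HasFDerivWithinAt f (0 : F →L[ℝ] ℝ) M x)
    {x y : F} (hx : x ∈ M) (hy : y ∈ M) : f x = f y := by
  have hloc : IsLocallyConstant (fun z : M => f z) := by
    rw [IsLocallyConstant.iff_eventually_eq]
    rintro ⟨x, hx⟩
    obtain ⟨U, r, hxU, hr, -⟩ := hM.exists_retraction hx
    obtain ⟨ε, hε, hεU⟩ := Metric.isOpen_iff.1 hr.isOpen x hxU
    have hd : ∀ y ∈ Metric.ball x ε,
        HasFDerivWithinAt (fun z => f (r z)) (0 : F →L[ℝ] ℝ) (Metric.ball x ε) y := by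
      intro y hy
      have := (hf (r y) (hr.mapsTo (hεU hy))).comp y
        ((hr.hasFDerivAt (hεU hy)).hasFDerivWithinAt (s := U)) hr.mapsTo
      rw [ContinuousLinearMap.zero_comp] at this
      exact this.mono hεU
    have hcst : ∀ y ∈ Metric.ball x ε, f (r y) = f (r x) := by
      intro y hy
      refine (convex_ball x ε).is_const_of_fderivWithin_eq_zero (𝕜 := ℝ) (f := fun z => f (r z))
        (fun z hz => (hd z hz).differentiableWithinAt) (fun z hz => ?_) hy
        (Metric.mem_ball_self hε)
      exact (hd z hz).fderivWithin (Metric.isOpen_ball.uniqueDiffWithinAt hz)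
    have hn : ∀ᶠ z : M in nhds ⟨x, hx⟩, (z : F) ∈ Metric.ball x ε :=
      continuous_subtype_val.continuousAt.eventually (Metric.ball_mem_nhds x hε)
    filter_upwards [hn] with z hz
    have := hcst z hz
    rwa [hr.fixed z z.2 (hεU hz), hr.fixed x hx hxU] at this
  have := isPreconnected_iff_preconnectedSpace.1 hc
  exact hloc.apply_eq_of_preconnectedSpace ⟨x, hx⟩ ⟨y, hy⟩

/-! ### Geometry of cones -/

section Cone

variable {N : ℕ} {v : E N} {I : Set ℝ} {S : Set (E N)}

theorem rulingVector_add_smul {s : ℝ} (hs : 0 < s) {y : E N} (hy : ‖y‖ = 1) :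
    rulingVector v (v + s • y) = y := by
  rw [rulingVector, add_sub_cancel_left, norm_smul, hy, mul_one, Real.norm_of_nonneg hs.le,
    inv_smul_smul₀ hs.ne']

theorem hasFDerivAt_norm_sub {s : ℝ} (hs : 0 < s) {y : E N} (hy : ‖y‖ = 1) :
    HasFDerivAt (fun x => ‖x - v‖) (innerSL ℝ y) (v + s • y) := by
  have hd : HasFDerivAt (fun x => ‖x - v‖) (fderiv ℝ (fun x => ‖x - v‖) (v + s • y))
      (v + s • y) := by
    refine (DifferentiableAt.norm ℝ (by fun_prop) ?_).hasFDerivAt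
    rw [add_sub_cancel_left]
    exact smul_ne_zero hs.ne' (by rintro rfl; simp at hy)
  -- The derivative is read off from that of the squared norm, after cancelling `2s`.
  have h1 := hd.pow 2
  have h2 : HasFDerivAt (fun x : E N => ‖x - v‖ ^ 2) (2 • (innerSL ℝ (v + s • y - v)))
      (v + s • y) := by
    have := ((hasFDerivAt_id (v + s • y)).sub_const v).norm_sq
    simpa using this
  have h3 := h1.unique h2
  refine hd.congr_fderiv ?_
  ext1 w
  have h4 := congrArg (fun f => f w) h3
  simp only [add_sub_cancel_left, norm_smul, hy, Real.norm_of_nonneg hs.le] at h4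
  simp at h4
  have h5 : 2 * s * (fderiv ℝ (fun x => ‖x - v‖) (v + s • y)) w = 2 * s * ⟪y, w⟫_ℝ := by
    rw [h4, mul_assoc]
  simpa using mul_left_cancel₀ (by positivity) h5

theorem hasFDerivAt_rulingVector {s : ℝ} (hs : 0 < s) {y : E N} (hy : ‖y‖ = 1) :
    HasFDerivAt (rulingVector v)
      (s⁻¹ • (ContinuousLinearMap.id ℝ (E N) - (innerSL ℝ y).smulRight y)) (v + s • y) := by
  have hn : ‖v + s • y - v‖ = s := by
    rw [add_sub_cancel_left, norm_smul, hy, mul_one, Real.norm_of_nonneg hs.le]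
  have h1 := ((hasDerivAt_inv (by rw [hn]; exact hs.ne')).comp_hasFDerivAt (v + s • y)
    (hasFDerivAt_norm_sub (v := v) hs hy)).smul ((hasFDerivAt_id (v + s • y)).sub_const v)
  refine h1.congr_fderiv ?_
  ext1 w
  show (‖v + s • y - v‖)⁻¹ • w + (-(‖v + s • y - v‖ ^ 2)⁻¹ * ⟪y, w⟫_ℝ) • (v + s • y - v) =
    s⁻¹ • (w - ⟪y, w⟫_ℝ • y)
  rw [hn, add_sub_cancel_left, smul_sub, sub_eq_add_neg, ← smul_neg, ← neg_smul, smul_smul,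
    smul_smul]
  congr 2
  field_simp

theorem contDiffOn_rulingVector : ContDiffOn ℝ ∞ (rulingVector v) {v}ᶜ := by
  intro x hx
  have hx' : x - v ≠ 0 := sub_ne_zero.2 hx
  have h : ContDiffAt ℝ ∞ (fun x => x - v) x := contDiffAt_id.sub contDiffAt_const
  exact (((h.norm ℝ hx').inv (norm_ne_zero_iff.2 hx')).smul h).contDiffWithinAt

section

variable (hS : S ⊆ Metric.sphere 0 1) (hI : I ⊆ Set.Ioi 0)

theorem mem_coneOver {s : ℝ} (hs : s ∈ I) {y : E N} (hy : y ∈ S) : v + s • y ∈ coneOver v I S :=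
  ⟨s, hs, y, hy, rfl⟩

include hS

theorem norm_eq_one_of_subset_sphere {y : E N} (hy : y ∈ S) : ‖y‖ = 1 := by simpa using hS hy

theorem inner_tangentSpace_eq_zero {y : E N} (hy : y ∈ S) {w : E N} (hw : w ∈ tangentSpace S y) :
    ⟪y, w⟫_ℝ = 0 := by
  have h1 : HasFDerivWithinAt (fun z : E N => ‖z‖ ^ 2) (2 • innerSL ℝ y) S y := by
    have := (hasFDerivAt_id y).norm_sq
    simpa using this.hasFDerivWithinAt
  have h2 : HasFDerivWithinAt (fun z : E N => ‖z‖ ^ 2) (0 : E N →L[ℝ] ℝ) S y := by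
    refine (hasFDerivWithinAt_const (1 : ℝ) y S).congr (fun z hz => ?_) ?_
    · simp [norm_eq_one_of_subset_sphere hS hz]
    · simp [norm_eq_one_of_subset_sphere hS hy]
  have h3 := eqOn_tangentSpace h1 h2 hw
  simpa using h3

include hI

theorem mapsTo_rulingVector : Set.MapsTo (rulingVector v) (coneOver v I S) S := by
  rintro x ⟨s, hs, y, hy, rfl⟩
  rwa [rulingVector_add_smul (hI hs) (norm_eq_one_of_subset_sphere hS hy)]

theorem coneOver_subset_compl : coneOver v I S ⊆ {v}ᶜ := by
  rintro x ⟨s, hs, y, hy, rfl⟩ h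
  have h0 : s • y = 0 := by simpa using h
  have hs0 : s ≠ 0 := (show (0 : ℝ) < s from hI hs).ne'
  rcases smul_eq_zero.1 h0 with h | h
  · exact hs0 h
  · have := norm_eq_one_of_subset_sphere hS hy
    simp [h] at this

/-- The derivative of `rulingVector` sends tangent vectors of the cone to the link and kills only
the radial direction. Conversely, dilated copies of the link and the rulings lie in the cone. -/
theorem tangentSpace_coneOver (hIo : IsOpen I) {s : ℝ} (hs : s ∈ I) {y : E N} (hy : y ∈ S) :
    tangentSpace (coneOver v I S) (v + s • y) = tangentSpace S y ⊔ ℝ ∙ y := by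
  have hs0 : 0 < s := hI hs
  have hy1 := norm_eq_one_of_subset_sphere hS hy
  apply le_antisymm
  · intro u hu
    have h1 := mem_tangentSpace_of_hasFDerivWithinAt
      (hasFDerivAt_rulingVector (v := v) hs0 hy1).hasFDerivWithinAt (mapsTo_rulingVector hS hI) hu
    rw [rulingVector_add_smul hs0 hy1] at h1
    have h2 : u = s • (s⁻¹ • (u - ⟪y, u⟫_ℝ • y)) + ⟪y, u⟫_ℝ • y := by
      rw [smul_inv_smul₀ hs0.ne']; abel
    rw [h2]
    exact Submodule.add_mem_sup (Submodule.smul_mem _ _ h1)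
      (Submodule.smul_mem _ _ (Submodule.mem_span_singleton_self y))
  · refine sup_le (fun w hw => ?_) ?_
    · have h1 : HasFDerivWithinAt (fun z => v + s • z) (s • ContinuousLinearMap.id ℝ (E N)) S y :=
        ((hasFDerivWithinAt_id y S).const_smul s).const_add v
      have h2 := mem_tangentSpace_of_hasFDerivWithinAt h1 (fun z hz => mem_coneOver (v := v) hs hz) hw
      exact (Submodule.smul_mem_iff _ hs0.ne').1 h2
    · rw [Submodule.span_singleton_le_iff_mem]
      have h1 : HasFDerivWithinAt (fun σ : ℝ => v + σ • y)
          ((ContinuousLinearMap.id ℝ ℝ).smulRight y) I s :=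
        (((ContinuousLinearMap.id ℝ ℝ).smulRight y).hasFDerivWithinAt).const_add v
      have h2 : (1 : ℝ) ∈ tangentSpace I s := by
        rw [tangentSpace, tangentConeAt_of_mem_nhds (hIo.mem_nhds hs), Submodule.span_univ]
        trivial
      have h3 := mem_tangentSpace_of_hasFDerivWithinAt h1 (fun σ hσ => mem_coneOver (v := v) hσ hy) h2
      simpa using h3

theorem finrank_tangentSpace_coneOver (hIo : IsOpen I) {s : ℝ} (hs : s ∈ I) {y : E N} (hy : y ∈ S) :
    Module.finrank ℝ (tangentSpace (coneOver v I S) (v + s • y)) =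
      Module.finrank ℝ (tangentSpace S y) + 1 := by
  have hy0 : y ≠ 0 := by
    rintro rfl
    simpa using norm_eq_one_of_subset_sphere hS hy
  rw [tangentSpace_coneOver hS hI hIo hs hy, ← finrank_span_singleton (K := ℝ) hy0,
    ← Submodule.finrank_sup_add_finrank_inf_eq]
  have : tangentSpace S y ⊓ ℝ ∙ y = ⊥ := by
    rw [eq_bot_iff]
    rintro w ⟨hw, hwy⟩
    obtain ⟨c, rfl⟩ := Submodule.mem_span_singleton.1 hwy
    have := inner_tangentSpace_eq_zero hS hy hw
    rw [inner_smul_right, real_inner_self_eq_norm_sq, norm_eq_one_of_subset_sphere hS hy] at this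
    have hc : c = 0 := by simpa using this
    simp [hc]
  rw [this, finrank_bot, add_zero]

/-- The retraction keeps the distance to the vertex and retracts the direction onto the link. -/
theorem IsSubmanifold.coneOver {d : ℕ} (hSM : IsSubmanifold d S) (hIo : IsOpen I) :
    IsSubmanifold (d + 1) (coneOver v I S) := by
  refine isSubmanifold_of_retraction ?_
  rintro x ⟨s, hs, y, hy, rfl⟩
  have hs0 : 0 < s := hI hs
  have hy1 := norm_eq_one_of_subset_sphere hS hy
  obtain ⟨U, r, hyU, hr, hd⟩ := hSM.exists_retraction hy
  have hV : IsOpen ({v}ᶜ ∩ rulingVector v ⁻¹' U : Set (E N)) :=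
    contDiffOn_rulingVector.continuousOn.isOpen_inter_preimage isOpen_compl_singleton hr.isOpen
  have hV2 : IsOpen (({v}ᶜ ∩ rulingVector v ⁻¹' U) ∩ (fun x => ‖x - v‖) ⁻¹' I : Set (E N)) :=
    hV.inter (hIo.preimage (by fun_prop))
  have hn : ContDiffOn ℝ ∞ (fun x => ‖x - v‖) {v}ᶜ := fun x hx =>
    (ContDiffAt.norm ℝ (contDiffAt_id.sub contDiffAt_const) (sub_ne_zero.2 hx)).contDiffWithinAt
  have hn' : ∀ {s : ℝ}, s ∈ I → ∀ {y : E N}, y ∈ S → ‖v + s • y - v‖ = s := by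
    intro s hs y hy
    rw [add_sub_cancel_left, norm_smul, norm_eq_one_of_subset_sphere hS hy, mul_one,
      Real.norm_of_nonneg (le_of_lt (hI hs))]
  obtain ⟨U', hU', hR⟩ := IsRetraction.of_nhds (M := TwistedAustere.coneOver v I S)
    (r := fun x => v + ‖x - v‖ • r (rulingVector v x)) hV2
    (contDiffOn_const.add ((hn.mono fun x hx => hx.1.1).smul
      (hr.contDiffOn.comp (contDiffOn_rulingVector.mono fun x hx => hx.1.1) fun x hx => hx.1.2)))
    (fun x hx => ⟨_, hx.2, _, hr.mapsTo hx.1.2, rfl⟩)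
    (by
      rintro x ⟨s, hs, y, hy, rfl⟩ hxU
      have h2 : rulingVector v (v + s • y) = y :=
        rulingVector_add_smul (hI hs) (norm_eq_one_of_subset_sphere hS hy)
      have h3 : y ∈ U := by simpa [h2] using hxU.1.2
      show v + ‖v + s • y - v‖ • r (rulingVector v (v + s • y)) = v + s • y
      rw [hn' hs hy, h2, hr.fixed y hy h3])
    (mem_coneOver hs hy)
    ⟨⟨coneOver_subset_compl hS hI (mem_coneOver hs hy), by
      rw [Set.mem_preimage, rulingVector_add_smul hs0 hy1]; exact hyU⟩, by
      rw [Set.mem_preimage, hn' hs hy]; exact hs⟩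
  exact ⟨U', _, hU', hR, by rw [finrank_tangentSpace_coneOver hS hI hIo hs hy, hd]⟩

/-- Dilating into the cone, retracting there and projecting along the rulings retracts onto the
link. -/
theorem IsSubmanifold.of_coneOver {d : ℕ} (hM : IsSubmanifold (d + 1) (TwistedAustere.coneOver v I S))
    (hIo : IsOpen I) {s : ℝ} (hs : s ∈ I) : IsSubmanifold d S := by
  refine isSubmanifold_of_retraction fun y hy => ?_
  have hs0 : 0 < s := hI hs
  have hy1 := norm_eq_one_of_subset_sphere hS hy
  have hx := mem_coneOver (v := v) hs hy
  obtain ⟨U, r, hxU, hr, hd⟩ := hM.exists_retraction hx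
  have hc : ContDiff ℝ ∞ (fun z : E N => v + s • z) := contDiff_const.add (contDiff_id.const_smul s)
  obtain ⟨U', hU', hR⟩ := IsRetraction.of_nhds (M := S)
    (r := fun z => rulingVector v (r (v + s • z))) (hr.isOpen.preimage hc.continuous)
    (contDiffOn_rulingVector.comp (hr.contDiffOn.comp hc.contDiffOn fun z hz => hz) fun z hz =>
      coneOver_subset_compl hS hI (hr.mapsTo hz))
    (fun z hz => mapsTo_rulingVector hS hI (hr.mapsTo hz))
    (fun z hz hzU => by
      rw [hr.fixed _ (mem_coneOver hs hz) hzU,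
        rulingVector_add_smul hs0 (norm_eq_one_of_subset_sphere hS hz)]) hy hxU
  refine ⟨U', _, hU', hR, ?_⟩
  rw [finrank_tangentSpace_coneOver hS hI hIo hs hy] at hd
  omega

omit hI in
-- The radial component of `II` is that of the unit sphere, obtained by differentiating `⟪z, W z⟫ =
-- 0` for a tangent field `W`.
theorem inner_secondFundamentalForm_link {d : ℕ} (hSM : IsSubmanifold d S) {y : E N} (hy : y ∈ S)
    {w₁ w₂ : E N} (h₁ : w₁ ∈ tangentSpace S y) (h₂ : w₂ ∈ tangentSpace S y) :
    ⟪y, secondFundamentalForm S y w₁ w₂⟫_ℝ = -⟪w₁, w₂⟫_ℝ := by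
  have h := (hasFDerivWithinAt_id y S).inner ℝ (hSM.hasFDerivWithinAt_tangentExtension hy w₂)
  have h0 : HasFDerivWithinAt (fun z => ⟪id z, tangentExtension S w₂ z⟫_ℝ) (0 : E N →L[ℝ] ℝ) S y := by
    refine (hasFDerivWithinAt_const (0 : ℝ) y S).congr (fun z hz => ?_) ?_
    · exact inner_tangentSpace_eq_zero hS hz (projField_mem S z w₂)
    · exact inner_tangentSpace_eq_zero hS hy (projField_mem S y w₂)
  have h3 := eqOn_tangentSpace h h0 h₁
  have h4 : tangentExtension S w₂ y = w₂ := projField_eq_self h₂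
  rw [hSM.secondFundamentalForm_eq hy h₁ h₂]
  simp [fderivInnerCLM_apply, h4] at h3
  linarith

end

/-! ### The second fundamental form of a cone -/

section

variable {d : ℕ} (hS : S ⊆ Metric.sphere 0 1) (hI : I ⊆ Set.Ioi 0) (hIo : IsOpen I)
  (hM : IsSubmanifold (d + 1) (coneOver v I S)) {s : ℝ} (hs : s ∈ I) {y : E N} (hy : y ∈ S)
include hS hI hIo hs hy

theorem tangentSpace_le_coneOver {w : E N} (hw : w ∈ tangentSpace S y) :
    w ∈ tangentSpace (coneOver v I S) (v + s • y) := by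
  rw [tangentSpace_coneOver hS hI hIo hs hy]
  exact Submodule.mem_sup_left hw

theorem ruling_mem_tangentSpace : y ∈ tangentSpace (coneOver v I S) (v + s • y) := by
  rw [tangentSpace_coneOver hS hI hIo hs hy]
  exact Submodule.mem_sup_right (Submodule.mem_span_singleton_self y)

include hM

/-- The field `x - v` is tangent to the cone and its derivative is the identity, which has no normal
part on tangent vectors. -/
theorem secondFundamentalForm_ruling_right {w : E N}
    (hw : w ∈ tangentSpace (coneOver v I S) (v + s • y)) :
    secondFundamentalForm (coneOver v I S) (v + s • y) w y = 0 := by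
  have hx := mem_coneOver (v := v) hs hy
  have hs0 : s ≠ 0 := (show (0 : ℝ) < s from hI hs).ne'
  have h := hM.projDeriv_field hx (W := fun x => x - v)
    ((hasFDerivWithinAt_id (v + s • y) _).sub_const v) (by
      filter_upwards [self_mem_nhdsWithin] with x hx
      obtain ⟨s, hs, z, hz, rfl⟩ := hx
      rw [add_sub_cancel_left]
      exact Submodule.smul_mem _ _ (ruling_mem_tangentSpace hS hI hIo hs hz)) hw
  rw [hM.secondFundamentalForm_eq hx hw (ruling_mem_tangentSpace hS hI hIo hs hy)]
  simp only [add_sub_cancel_left, map_smul, ContinuousLinearMap.coe_id', id_eq,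
    projField_eq_self hw, sub_self] at h
  exact (smul_eq_zero.1 h).resolve_left hs0

theorem secondFundamentalForm_ruling_left {w : E N}
    (hw : w ∈ tangentSpace (coneOver v I S) (v + s • y)) :
    secondFundamentalForm (coneOver v I S) (v + s • y) y w = 0 := by
  rw [hM.secondFundamentalForm_symm (mem_coneOver hs hy)
    (ruling_mem_tangentSpace hS hI hIo hs hy) hw]
  exact secondFundamentalForm_ruling_right hS hI hIo hM hs hy hw

/-- The second fundamental form of a cone, in terms of the one of the link. -/
theorem smul_secondFundamentalForm_coneOver {w₁ w₂ : E N} (h₁ : w₁ ∈ tangentSpace S y)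
    (h₂ : w₂ ∈ tangentSpace S y) :
    s • secondFundamentalForm (coneOver v I S) (v + s • y) w₁ w₂ =
      secondFundamentalForm S y w₁ w₂ + ⟪w₁, w₂⟫_ℝ • y := by
  have hSM : IsSubmanifold d S := IsSubmanifold.of_coneOver hS hI hM hIo hs
  have hx := mem_coneOver (v := v) hs hy
  have hs0 : 0 < s := hI hs
  have hy1 := norm_eq_one_of_subset_sphere hS hy
  have hρ := rulingVector_add_smul (v := v) hs0 hy1
  have hP : HasFDerivWithinAt (tangentExtension S w₂)
      ((fderivWithin ℝ (projField S) S y).flip w₂) S (rulingVector v (v + s • y)) := by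
    rw [hρ]; exact hSM.hasFDerivWithinAt_tangentExtension hy w₂
  -- The tangent field on the link is extended to be constant along the rulings; the derivative of
  -- `rulingVector` produces the factor `s⁻¹`.
  have hW := hP.comp (v + s • y) (hasFDerivAt_rulingVector (v := v) hs0 hy1).hasFDerivWithinAt
    (mapsTo_rulingVector hS hI)
  have h := hM.secondFundamentalForm_field hx hW (by
      filter_upwards [self_mem_nhdsWithin] with x hx
      obtain ⟨s, hs, z, hz, rfl⟩ := hx
      rw [Function.comp_apply, rulingVector_add_smul (hI hs) (norm_eq_one_of_subset_sphere hS hz)]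
      exact tangentSpace_le_coneOver hS hI hIo hs hz (projField_mem S z w₂))
    (tangentSpace_le_coneOver hS hI hIo hs hy h₁)
  have hW0 : (tangentExtension S w₂ ∘ rulingVector v) (v + s • y) = w₂ := by
    rw [Function.comp_apply, hρ]; exact projField_eq_self h₂
  rw [hW0] at h
  have hW1 : ((fderivWithin ℝ (projField S) S y).flip w₂ ∘SL
      (s⁻¹ • (ContinuousLinearMap.id ℝ (E N) - (innerSL ℝ y).smulRight y))) w₁ =
      s⁻¹ • secondFundamentalForm S y w₁ w₂ := by
    rw [hSM.secondFundamentalForm_eq hy h₁ h₂]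
    simp [inner_tangentSpace_eq_zero hS hy h₁]
  rw [hW1] at h
  set n := secondFundamentalForm S y w₁ w₂ with hn
  have hnS : n ∈ (tangentSpace S y)ᗮ := secondFundamentalForm_mem y w₁ w₂
  have hin := inner_secondFundamentalForm_link hS hSM hy h₁ h₂
  -- `n` is normal to the link, so only its radial component is tangent to the cone.
  have hPn : projField (coneOver v I S) (v + s • y) n = -⟪w₁, w₂⟫_ℝ • y := by
    refine Submodule.eq_starProjection_of_mem_orthogonal
      (Submodule.smul_mem _ _ (ruling_mem_tangentSpace hS hI hIo hs hy)) ?_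
    rw [tangentSpace_coneOver hS hI hIo hs hy, Submodule.mem_orthogonal]
    intro u hu
    obtain ⟨a, ha, b, hb, rfl⟩ := Submodule.mem_sup.1 hu
    obtain ⟨c, rfl⟩ := Submodule.mem_span_singleton.1 hb
    have hya : ⟪a, y⟫_ℝ = 0 := (real_inner_comm _ _).trans (inner_tangentSpace_eq_zero hS hy ha)
    rw [inner_add_left, inner_sub_right, inner_sub_right, inner_smul_left, inner_smul_left,
      inner_smul_right, inner_smul_right, hin, real_inner_self_eq_norm_sq, hy1,
      (Submodule.mem_orthogonal _ _).1 hnS a ha, hya]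
    simp
  rw [h, map_smul, hPn, smul_sub, smul_inv_smul₀ hs0.ne', smul_inv_smul₀ hs0.ne', neg_smul,
    sub_neg_eq_add]

end

end Cone

/-! ### One-forms on cones -/

section ConeForms

variable {N : ℕ} {v : E N} {I : Set ℝ} {S : Set (E N)} {d : ℕ} {μ : E N → (E N →L[ℝ] ℝ)}

theorem hasFDerivWithinAt_of_contDiffOn {F G : Type*} [NormedAddCommGroup F] [NormedSpace ℝ F]
    [NormedAddCommGroup G] [NormedSpace ℝ G] {M : Set F} {f : F → G} (hf : ContDiffOn ℝ ∞ f M)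
    {x : F} (hx : x ∈ M) : HasFDerivWithinAt f (fderivWithin ℝ f M x) M x :=
  ((hf x hx).differentiableWithinAt (by simp)).hasFDerivWithinAt

section

variable (hμ : ContDiffOn ℝ ∞ μ (coneOver v I S)) {s : ℝ} (hs : s ∈ I) {y : E N} (hy : y ∈ S)
include hμ hs hy

theorem hasDerivAt_along_ruling (hIo : IsOpen I) (w : E N) :
    HasDerivAt (fun σ : ℝ => μ (v + σ • y) w)
      (fderivWithin ℝ μ (coneOver v I S) (v + s • y) y w) s := by
  have h1 : HasDerivWithinAt (fun σ : ℝ => v + σ • y) y I s := by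
    simpa using (((hasDerivWithinAt_id s I).smul_const y).const_add v)
  have h2 := (hasFDerivWithinAt_of_contDiffOn hμ (mem_coneOver hs hy)).comp_hasDerivWithinAt s h1
    (fun σ hσ => mem_coneOver hσ hy)
  have h3 := (h2.hasDerivAt (hIo.mem_nhds hs)).clm_apply (hasDerivAt_const s w)
  simpa using h3

theorem hasFDerivWithinAt_pullback :
    HasFDerivWithinAt (fun z => μ (v + s • z))
      (s • fderivWithin ℝ μ (coneOver v I S) (v + s • y)) S y := by
  have h1 : HasFDerivWithinAt (fun z : E N => v + s • z) (s • ContinuousLinearMap.id ℝ (E N)) S y :=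
    ((hasFDerivWithinAt_id y S).const_smul s).const_add v
  have h2 := (hasFDerivWithinAt_of_contDiffOn hμ (mem_coneOver hs hy)).comp y h1
    (fun z hz => mem_coneOver hs hz)
  refine h2.congr_fderiv ?_
  ext1 w
  simp

/-- By `covariantDerivative_ruling_right`, the second term is `s (∇μ)(w, y)` on vectors `w` tangent
to the link. It vanishes for split pairs, which leaves `μ` as the differential of the slope. -/
theorem hasFDerivWithinAt_slope_link :
    HasFDerivWithinAt (fun z => μ (v + s • z) z)
      (μ (v + s • y) + s • (fderivWithin ℝ μ (coneOver v I S) (v + s • y)).flip y) S y := by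
  have h := (hasFDerivWithinAt_pullback hμ hs hy).clm_apply (hasFDerivWithinAt_id y S)
  refine h.congr_fderiv ?_
  ext1 w
  simp

end

section

variable (hS : S ⊆ Metric.sphere 0 1) (hI : I ⊆ Set.Ioi 0) (hIo : IsOpen I)
  (hM : IsSubmanifold (d + 1) (coneOver v I S)) (hμ : ContDiffOn ℝ ∞ μ (coneOver v I S))
  {s : ℝ} (hs : s ∈ I) {y : E N} (hy : y ∈ S)
include hS hI hIo hM hμ hs hy

/-- Rulings are null for `II`, so no correction appears. With `hasDerivAt_along_ruling`, this turns
`(∇μ)(e₀, w)` into a derivative with respect to `s`. -/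
theorem covariantDerivative_ruling_left {w : E N}
    (hw : w ∈ tangentSpace (coneOver v I S) (v + s • y)) :
    covariantDerivative (coneOver v I S) μ (v + s • y) y w =
      fderivWithin ℝ μ (coneOver v I S) (v + s • y) y w := by
  have hx := mem_coneOver (v := v) hs hy
  rw [hM.covariantDerivative_eq hx (hasFDerivWithinAt_of_contDiffOn hμ hx)
    (ruling_mem_tangentSpace hS hI hIo hs hy) hw,
    secondFundamentalForm_ruling_left hS hI hIo hM hs hy hw, map_zero, add_zero]

theorem covariantDerivative_ruling_right {w : E N}
    (hw : w ∈ tangentSpace (coneOver v I S) (v + s • y)) :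
    covariantDerivative (coneOver v I S) μ (v + s • y) w y =
      fderivWithin ℝ μ (coneOver v I S) (v + s • y) w y := by
  have hx := mem_coneOver (v := v) hs hy
  rw [hM.covariantDerivative_eq hx (hasFDerivWithinAt_of_contDiffOn hμ hx) hw
    (ruling_mem_tangentSpace hS hI hIo hs hy),
    secondFundamentalForm_ruling_right hS hI hIo hM hs hy hw, map_zero, add_zero]

/-- The Hessian on the link of a function whose differential is induced by `μ`. -/
theorem covariantDerivative_link {m : E N → ℝ}
    (hm : ∀ z ∈ S, ∀ w ∈ tangentSpace S z, fderivWithin ℝ m S z w = μ (v + s • z) w)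
    {w₁ w₂ : E N} (h₁ : w₁ ∈ tangentSpace S y) (h₂ : w₂ ∈ tangentSpace S y) :
    covariantDerivative S (fun z => fderivWithin ℝ m S z) y w₁ w₂ =
      s * covariantDerivative (coneOver v I S) μ (v + s • y) w₁ w₂ -
        ⟪w₁, w₂⟫_ℝ * μ (v + s • y) y := by
  have hSM : IsSubmanifold d S := IsSubmanifold.of_coneOver hS hI hM hIo hs
  have hx := mem_coneOver (v := v) hs hy
  have hII := smul_secondFundamentalForm_coneOver hS hI hIo hM hs hy h₁ h₂
  rw [hSM.covariantDerivative_fderivWithin hy hm h₁ h₂,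
    hSM.covariantDerivative_eq hy (hasFDerivWithinAt_pullback hμ hs hy) h₁ h₂,
    hM.covariantDerivative_eq hx (hasFDerivWithinAt_of_contDiffOn hμ hx)
      (tangentSpace_le_coneOver hS hI hIo hs hy h₁) (tangentSpace_le_coneOver hS hI hIo hs hy h₂),
    eq_sub_of_add_eq hII.symm]
  simp
  ring

end

/-! ### Adapted frames -/

/-- An orthonormal basis of the tangent plane of a surface. -/
def linkFrame (S : Set (E N)) (y : E N) (i : Fin 2) : E N :=
  if h : Module.finrank ℝ (tangentSpace S y) = 2 then
    (stdOrthonormalBasis ℝ (tangentSpace S y) (Fin.cast h.symm i) : E N) else 0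

theorem linkFrame_mem (S : Set (E N)) (y : E N) (i : Fin 2) :
    linkFrame S y i ∈ tangentSpace S y := by
  unfold linkFrame
  split_ifs
  · exact Subtype.prop _
  · exact zero_mem _

theorem orthonormal_linkFrame {y : E N} (h : Module.finrank ℝ (tangentSpace S y) = 2) :
    Orthonormal ℝ (linkFrame S y) := by
  have h1 := (stdOrthonormalBasis ℝ (tangentSpace S y)).orthonormal.comp (Fin.cast h.symm)
    (Fin.cast_injective _)
  rw [orthonormal_iff_ite] at h1 ⊢
  intro i j
  simpa [linkFrame, h] using h1 i j

theorem sum_stdOrthonormalBasis_eq {G : Type*} [AddCommMonoid G] {y : E N}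
    (h : Module.finrank ℝ (tangentSpace S y) = 2) (f : E N → G) :
    ∑ i, f (stdOrthonormalBasis ℝ (tangentSpace S y) i : E N) =
      f (linkFrame S y 0) + f (linkFrame S y 1) := by
  rw [← Fin.sum_univ_two (fun i => f (linkFrame S y i)), ← (finCongr h).symm.sum_comp]
  refine Finset.sum_congr rfl fun i _ => ?_
  simp [linkFrame, h]

/-- The frame of a cone consisting of the ruling vector and a frame of the link. -/
def coneFrame (v : E N) (S : Set (E N)) (x : E N) : Fin 3 → E N :=
  Fin.cons (rulingVector v x) (linkFrame S (rulingVector v x))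

/-! ### Laplacian and mean curvature of the link -/

section

variable (hS : S ⊆ Metric.sphere 0 1) (hI : I ⊆ Set.Ioi 0) (hIo : IsOpen I)
  (hM : IsSubmanifold 3 (coneOver v I S)) {s : ℝ} (hs : s ∈ I) {y : E N} (hy : y ∈ S)
include hS hI hs hy

omit hI hs in
theorem coneFrame_eq (hs0 : 0 < s) : coneFrame v S (v + s • y) 0 = y ∧
    coneFrame v S (v + s • y) 1 = linkFrame S y 0 ∧
    coneFrame v S (v + s • y) 2 = linkFrame S y 1 := by
  have h : rulingVector v (v + s • y) = y :=
    rulingVector_add_smul hs0 (norm_eq_one_of_subset_sphere hS hy)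
  simp only [coneFrame, h]
  exact ⟨rfl, rfl, rfl⟩

include hIo hM

theorem finrank_tangentSpace_link : Module.finrank ℝ (tangentSpace S y) = 2 :=
  IsSubmanifold.finrank_tangentSpace (IsSubmanifold.of_coneOver hS hI (d := 2) hM hIo hs) hy

theorem coneFrame_spec : Orthonormal ℝ (coneFrame v S (v + s • y)) ∧
    ∀ i, coneFrame v S (v + s • y) i ∈ tangentSpace (coneOver v I S) (v + s • y) := by
  have hs0 : 0 < s := hI hs
  have hy1 := norm_eq_one_of_subset_sphere hS hy
  have hρ : rulingVector v (v + s • y) = y := rulingVector_add_smul hs0 hy1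
  have hl := orthonormal_linkFrame (finrank_tangentSpace_link hS hI hIo hM hs hy)
  rw [orthonormal_iff_ite] at hl
  have h0 : ∀ i, ⟪y, linkFrame S y i⟫_ℝ = 0 := fun i =>
    inner_tangentSpace_eq_zero hS hy (linkFrame_mem S y i)
  simp only [coneFrame, hρ]
  constructor
  · rw [orthonormal_iff_ite]
    intro i j
    refine Fin.cases ?_ (fun i => ?_) i <;> refine Fin.cases ?_ (fun j => ?_) j
    · simp [hy1]
    · simp [h0, (Fin.succ_ne_zero j).symm]
    · simp [real_inner_comm y, h0]
    · simp [hl]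
  · intro i
    refine Fin.cases ?_ (fun i => ?_) i
    · exact ruling_mem_tangentSpace hS hI hIo hs hy
    · exact tangentSpace_le_coneOver hS hI hIo hs hy (linkFrame_mem S y i)

/-- The term `-2 μ(y)` comes from the radial part of `II` of the link, once for each frame vector.
The left side does not involve `s`, so equations at different distances can be compared. -/
theorem laplacian_link (hμ : ContDiffOn ℝ ∞ μ (coneOver v I S)) {m : E N → ℝ}
    (hm : ∀ z ∈ S, ∀ w ∈ tangentSpace S z, fderivWithin ℝ m S z w = μ (v + s • z) w) :
    laplacian S m y =
      s * (covariantDerivative (coneOver v I S) μ (v + s • y) (linkFrame S y 0) (linkFrame S y 0) +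
        covariantDerivative (coneOver v I S) μ (v + s • y) (linkFrame S y 1) (linkFrame S y 1)) -
        2 * μ (v + s • y) y := by
  have h2 := finrank_tangentSpace_link hS hI hIo hM hs hy
  have hl := orthonormal_iff_ite.1 (orthonormal_linkFrame h2)
  have hcov : ∀ i, covariantDerivative S (fun z => fderivWithin ℝ m S z) y (linkFrame S y i)
      (linkFrame S y i) = s * covariantDerivative (coneOver v I S) μ (v + s • y) (linkFrame S y i)
      (linkFrame S y i) - μ (v + s • y) y := by
    intro i
    rw [covariantDerivative_link hS hI hIo (d := 2) hM hμ hs hy hm (linkFrame_mem S y i)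
      (linkFrame_mem S y i), hl i i]
    simp
  rw [laplacian, sum_stdOrthonormalBasis_eq h2
    (fun w => covariantDerivative S (fun z => fderivWithin ℝ m S z) y w w), hcov, hcov]
  ring

/-- The mean curvature vector of the link in the sphere, and the one of the cone. -/
theorem meanCurvature_link :
    ∑ i, (ℝ ∙ y)ᗮ.starProjection (secondFundamentalForm S y
      (stdOrthonormalBasis ℝ (tangentSpace S y) i : E N)
      (stdOrthonormalBasis ℝ (tangentSpace S y) i : E N)) =
    s • (secondFundamentalForm (coneOver v I S) (v + s • y) (linkFrame S y 0) (linkFrame S y 0) +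
      secondFundamentalForm (coneOver v I S) (v + s • y) (linkFrame S y 1) (linkFrame S y 1)) := by
  have h2 := finrank_tangentSpace_link hS hI hIo hM hs hy
  have hSM : IsSubmanifold 2 S := IsSubmanifold.of_coneOver hS hI hM hIo hs
  have hy1 := norm_eq_one_of_subset_sphere hS hy
  have hII : ∀ i, (ℝ ∙ y)ᗮ.starProjection (secondFundamentalForm S y (linkFrame S y i)
      (linkFrame S y i)) = s • secondFundamentalForm (coneOver v I S) (v + s • y) (linkFrame S y i)
      (linkFrame S y i) := by
    intro i
    have hi := linkFrame_mem S y i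
    rw [smul_secondFundamentalForm_coneOver hS hI hIo (d := 2) hM hs hy hi hi,
      Submodule.starProjection_orthogonal_val, Submodule.starProjection_unit_singleton ℝ hy1,
      inner_secondFundamentalForm_link hS hSM hy hi hi, neg_smul, sub_neg_eq_add]
  rw [sum_stdOrthonormalBasis_eq h2 (fun w => (ℝ ∙ y)ᗮ.starProjection
    (secondFundamentalForm S y w w)), hII, hII, smul_add]

/-- Only the elementary symmetric function of degree one is needed: taking the mean curvature vector
`H` itself as normal, the trace of `A^H` is `|H|²`. The ruling contributes nothing to `H`. -/
theorem IsAustere.meanCurvature_eq_zero (hA : IsAustere (coneOver v I S)) :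
    secondFundamentalForm (coneOver v I S) (v + s • y) (linkFrame S y 0) (linkFrame S y 0) +
      secondFundamentalForm (coneOver v I S) (v + s • y) (linkFrame S y 1) (linkFrame S y 1) = 0 := by
  have hx := mem_coneOver (v := v) hs hy
  have hs0 : 0 < s := hI hs
  set M := coneOver v I S with hMdef
  set x := v + s • y with hxdef
  obtain ⟨ho, hm⟩ := coneFrame_spec hS hI hIo hM hs hy
  have hfr := hM.finrank_tangentSpace hx
  obtain ⟨b, hb⟩ := exists_orthonormalBasis_of_orthonormal hfr ho hm
  have hne : Nonempty (Fin (Module.finrank ℝ (tangentSpace M x))) := ⟨⟨0, by rw [hfr]; norm_num⟩⟩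
  set H := ∑ i, secondFundamentalForm M x (stdOrthonormalBasis ℝ (tangentSpace M x) i : E N)
    (stdOrthonormalBasis ℝ (tangentSpace M x) i : E N) with hH
  have hHn : H ∈ (tangentSpace M x)ᗮ := Submodule.sum_mem _ fun i _ => secondFundamentalForm_mem _ _ _
  have hH0 : H = 0 := by
    have h1 := hA x hx H hHn 1 (by rw [hfr]; norm_num) odd_one
    have h2 := Matrix.trace_eq_neg_charpoly_coeff (shapeMatrix M x H)
    rw [Fintype.card_fin, h1, neg_zero] at h2
    have h3 : (shapeMatrix M x H).trace = ⟪H, H⟫_ℝ := by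
      conv_rhs => rw [hH, inner_sum]
      rfl
    rw [h3] at h2
    exact inner_self_eq_zero.1 h2
  obtain ⟨B, hB⟩ := hM.exists_bilinear_secondFundamentalForm hx
  have h4 := sum_orthonormalBasis_eq B (stdOrthonormalBasis ℝ (tangentSpace M x)) b
  simp only [hB, hb] at h4
  rw [← hH, hH0, Fin.sum_univ_three] at h4
  obtain ⟨e0, e1, e2⟩ := coneFrame_eq (v := v) hS hy hs0
  rw [e0, e1, e2, secondFundamentalForm_ruling_left hS hI hIo (d := 2) hM hs hy
    (ruling_mem_tangentSpace hS hI hIo hs hy), zero_add] at h4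
  exact h4.symm

omit hIo hM in
/-- The differential of the homogeneous extension of `m`. -/
theorem hasFDerivWithinAt_homogeneousExtension {m : E N → ℝ} {m' : E N →L[ℝ] ℝ}
    (hm : HasFDerivWithinAt m m' S y) :
    ∃ f' : E N →L[ℝ] ℝ,
      HasFDerivWithinAt (homogeneousExtension v m) f' (coneOver v I S) (v + s • y) ∧
      f' y = m y ∧ ∀ w ∈ tangentSpace S y, f' w = m' w := by
  have hs0 : 0 < s := hI hs
  have hy1 := norm_eq_one_of_subset_sphere hS hy
  have hρ : rulingVector v (v + s • y) = y := rulingVector_add_smul hs0 hy1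
  have hn : ‖v + s • y - v‖ = s := by
    rw [add_sub_cancel_left, norm_smul, hy1, mul_one, Real.norm_of_nonneg hs0.le]
  have hm1 : HasFDerivWithinAt m m' S (rulingVector v (v + s • y)) := by rwa [hρ]
  have h1 := hm1.comp (v + s • y) (hasFDerivAt_rulingVector (v := v) hs0 hy1).hasFDerivWithinAt
    (mapsTo_rulingVector hS hI)
  have h2 := (hasFDerivAt_norm_sub (v := v) hs0 hy1).hasFDerivWithinAt (s := coneOver v I S) |>.mul h1
  refine ⟨_, h2, ?_, fun w hw => ?_⟩
  · simp [hρ, hy1]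
  · have h0 := inner_tangentSpace_eq_zero hS hy hw
    simp only [add_apply, smul_apply, hn, ContinuousLinearMap.coe_comp, Function.comp_apply,
      sub_apply, ContinuousLinearMap.smulRight_apply, innerSL_apply_apply, h0, zero_smul,
      ContinuousLinearMap.coe_id', id_eq, sub_zero, map_smul, smul_eq_mul, mul_zero, add_zero]
    rw [mul_inv_cancel_left₀ hs0.ne']

omit hM in
theorem eqOn_tangentSpace_coneOver {f g : E N →L[ℝ] ℝ} (h0 : f y = g y)
    (h : ∀ w ∈ tangentSpace S y, f w = g w) :
    ∀ w ∈ tangentSpace (coneOver v I S) (v + s • y), f w = g w := by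
  intro w hw
  rw [tangentSpace_coneOver hS hI hIo hs hy] at hw
  obtain ⟨a, ha, b, hb, rfl⟩ := Submodule.mem_sup.1 hw
  obtain ⟨c, rfl⟩ := Submodule.mem_span_singleton.1 hb
  simp [h a ha, h0]

end

end ConeForms

/-! ### Split twisted-austere pairs over cones -/

/-- The block has trace `p + q` for all `τ`, while its determinant has `τ²`-coefficient `-(a² +
d²)`. Thus the phase polynomial has leading coefficient `(a² + d²)(sin φ + b cos φ)`. -/
theorem splitPhase_family_eq_zero {φ b p q r a d : ℝ} (had : a ≠ 0 ∨ d ≠ 0)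
    (h : ∀ τ : ℝ, splitPhase φ b (p - τ * a) (r - τ * d) (r - τ * d) (q + τ * a) = 0) :
    Real.sin φ + Real.cos φ * b = 0 ∧ p + q = 0 := by
  have h1 := Real.sin_sq_add_cos_sq φ
  simp only [splitPhase] at h
  set S := Real.sin φ
  set C := Real.cos φ
  have h0 := h 0
  have hp := h 1
  have hn := h (-1)
  have had' : a ^ 2 + d ^ 2 ≠ 0 := by
    rcases had with h | h <;> positivity
  have hS : S + C * b = 0 := by
    -- The second difference at `-1, 0, 1` isolates the quadratic coefficient.
    have : (a ^ 2 + d ^ 2) * (S + C * b) = 0 := by linear_combination (hp + hn - 2 * h0) / 2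
    exact (mul_eq_zero.1 this).resolve_left had'
  refine ⟨hS, ?_⟩
  have hC : C ≠ 0 := by
    intro hC
    have : S = 0 := by simpa [hC] using hS
    simp [this, hC] at h1
  -- With `S = -C b`, the determinant terms cancel and only the trace survives.
  have h3 : C * (1 + b ^ 2) * (p + q) = 0 := by
    have hS' : S = -(C * b) := by linarith
    rw [hS'] at h0
    linear_combination h0
  have h4 : C * (1 + b ^ 2) ≠ 0 := mul_ne_zero hC (by positivity)
  exact (mul_eq_zero.1 h3).resolve_left h4

section

variable {N : ℕ} {v : E N} {I : Set ℝ} {S : Set (E N)} {μ : E N → (E N →L[ℝ] ℝ)} {θ : ℝ}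
  (hS : S ⊆ Metric.sphere 0 1) (hI : I ⊆ Set.Ioi 0) (hIo : IsOpen I)
  (hM : IsSubmanifold 3 (coneOver v I S)) (hμ : ContDiffOn ℝ ∞ μ (coneOver v I S))
include hS hI hIo hM hμ

/-- The twisted-austere equations for a split pair over a cone. -/
theorem isSpecialLagrangian_coneOver_iff
    (hsplit : ∀ s ∈ I, ∀ y ∈ S, ∀ w ∈ tangentSpace S y,
      covariantDerivative (coneOver v I S) μ (v + s • y) y w = 0 ∧
      covariantDerivative (coneOver v I S) μ (v + s • y) w y = 0) :
    IsSpecialLagrangian θ (twistedConormal (coneOver v I S) μ) ↔ ∀ s ∈ I, ∀ y ∈ S,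
      (∀ a ∈ tangentSpace (coneOver v I S) (v + s • y),
        ∀ b ∈ tangentSpace (coneOver v I S) (v + s • y),
          covariantDerivative (coneOver v I S) μ (v + s • y) a b =
            covariantDerivative (coneOver v I S) μ (v + s • y) b a) ∧
      ∀ ν ∈ (tangentSpace (coneOver v I S) (v + s • y))ᗮ, ∀ c : E N → E N → ℝ,
        (∀ a b, c a b = covariantDerivative (coneOver v I S) μ (v + s • y) a b -
          ⟪ν, secondFundamentalForm (coneOver v I S) (v + s • y) a b⟫_ℝ) →
        splitPhase (cophase N 3 θ) (c y y) (c (linkFrame S y 0) (linkFrame S y 0))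
          (c (linkFrame S y 0) (linkFrame S y 1)) (c (linkFrame S y 1) (linkFrame S y 0))
          (c (linkFrame S y 1) (linkFrame S y 1)) = 0 := by
  rw [hM.isSpecialLagrangian_iff hμ θ (t := coneFrame v S) (by
    rintro x ⟨s, hs, y, hy, rfl⟩
    exact coneFrame_spec hS hI hIo hM hs hy)]
  have key : ∀ s ∈ I, ∀ y ∈ S, ∀ ν : E N, ∀ c : E N → E N → ℝ,
      (∀ a b, c a b = covariantDerivative (coneOver v I S) μ (v + s • y) a b -
          ⟪ν, secondFundamentalForm (coneOver v I S) (v + s • y) a b⟫_ℝ) →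
      (Complex.exp (cophase N 3 θ * Complex.I) * (1 + Complex.I • Matrix.of fun i j : Fin 3 =>
        ((c (coneFrame v S (v + s • y) i) (coneFrame v S (v + s • y) j) : ℝ) : ℂ)).det).im =
        splitPhase (cophase N 3 θ) (c y y) (c (linkFrame S y 0) (linkFrame S y 0))
          (c (linkFrame S y 0) (linkFrame S y 1)) (c (linkFrame S y 1) (linkFrame S y 0))
          (c (linkFrame S y 1) (linkFrame S y 1)) := by
    intro s hs y hy ν c hc
    have hl : ∀ i, linkFrame S y i ∈ tangentSpace (coneOver v I S) (v + s • y) := fun i =>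
      tangentSpace_le_coneOver hS hI hIo hs hy (linkFrame_mem S y i)
    have h0 : ∀ i, c y (linkFrame S y i) = 0 ∧ c (linkFrame S y i) y = 0 := fun i => by
      obtain ⟨h1, h2⟩ := hsplit s hs y hy _ (linkFrame_mem S y i)
      rw [hc, hc, h1, h2, secondFundamentalForm_ruling_left hS hI hIo (d := 2) hM hs hy (hl i),
        secondFundamentalForm_ruling_right hS hI hIo (d := 2) hM hs hy (hl i)]
      simp
    obtain ⟨e0, e1, e2⟩ := coneFrame_eq (v := v) hS hy (show 0 < s from hI hs)
    refine (phase_fin_three (cophase N 3 θ)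
      (fun i j => c (coneFrame v S (v + s • y) i) (coneFrame v S (v + s • y) j)) ?_ ?_ ?_ ?_).trans
      ?_
    · simp only [e0, e1, h0]
    · simp only [e0, e2, h0]
    · simp only [e0, e1, h0]
    · simp only [e0, e2, h0]
    · simp only [e0, e1, e2]
  constructor
  · intro h s hs y hy
    obtain ⟨h1, h2⟩ := h _ (mem_coneOver hs hy)
    refine ⟨h1, fun ν hν c hc => ?_⟩
    have := h2 ν hν
    simp only [← hc] at this
    rw [← this, key s hs y hy ν c hc]
  · rintro h x ⟨s, hs, y, hy, rfl⟩
    obtain ⟨h1, h2⟩ := h s hs y hy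
    refine ⟨h1, fun ν hν => ?_⟩
    have := h2 ν hν (fun a b => covariantDerivative (coneOver v I S) μ (v + s • y) a b -
          ⟪ν, secondFundamentalForm (coneOver v I S) (v + s • y) a b⟫_ℝ) fun _ _ => rfl
    rw [← this, ← key s hs y hy ν _ fun _ _ => rfl]

end

/-! ### Rigidity of split pairs over austere cones -/

section

variable {N : ℕ} {v : E N} {I : Set ℝ} {S : Set (E N)} {μ : E N → (E N →L[ℝ] ℝ)} {θ : ℝ}

theorem eq_of_hasDerivAt_zero (hIo : IsOpen I) (hIc : I.OrdConnected) {f : ℝ → ℝ}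
    (hf : ∀ s ∈ I, HasDerivAt f 0 s) {s s' : ℝ} (hs : s ∈ I) (hs' : s' ∈ I) : f s = f s' :=
  hIo.is_const_of_deriv_eq_zero hIc.isPreconnected
    (fun s hs => (hf s hs).differentiableAt.differentiableWithinAt)
    (fun s hs => (hf s hs).deriv) hs hs'

variable (hS : S ⊆ Metric.sphere 0 1) (hI : I ⊆ Set.Ioi 0) (hIo : IsOpen I)
  (hM : IsSubmanifold 3 (coneOver v I S))
include hS hI hIo hM

/-- An austere cone which is not totally geodesic has a ruling along which `II` does not vanish. -/
theorem exists_secondFundamentalForm_ne_zero (hA : IsAustere (coneOver v I S))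
    (hng : ¬ IsTotallyGeodesic (coneOver v I S)) :
    ∃ y ∈ S, ∀ s ∈ I,
      secondFundamentalForm (coneOver v I S) (v + s • y) (linkFrame S y 0) (linkFrame S y 0) ≠ 0 ∨
      secondFundamentalForm (coneOver v I S) (v + s • y) (linkFrame S y 0) (linkFrame S y 1) ≠ 0 := by
  by_contra! hcon
  apply hng
  rintro x ⟨s, hs, y, hy, rfl⟩ a ha w hw
  have hx := mem_coneOver (v := v) hs hy
  have hs0 : s ≠ 0 := (show (0 : ℝ) < s from hI hs).ne'
  obtain ⟨s', hs', h00, h01⟩ := hcon y hy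
  -- `s • II` is determined by the link alone, so `II` vanishing at one point of a ruling vanishes
  -- along all of it.
  have htransfer : ∀ i j, secondFundamentalForm (coneOver v I S) (v + s' • y) (linkFrame S y i)
      (linkFrame S y j) = 0 → secondFundamentalForm (coneOver v I S) (v + s • y) (linkFrame S y i)
      (linkFrame S y j) = 0 := by
    intro i j h
    have h1 := smul_secondFundamentalForm_coneOver hS hI hIo (d := 2) hM hs' hy
      (linkFrame_mem S y i) (linkFrame_mem S y j)
    have h2 := smul_secondFundamentalForm_coneOver hS hI hIo (d := 2) hM hs hy
      (linkFrame_mem S y i) (linkFrame_mem S y j)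
    rw [← h1, h, smul_zero] at h2
    exact (smul_eq_zero.1 h2).resolve_left hs0
  have k00 := htransfer 0 0 h00
  have k01 := htransfer 0 1 h01
  have k11 := hA.meanCurvature_eq_zero hS hI hIo hM hs hy
  rw [k00, zero_add] at k11
  obtain ⟨ho, hm⟩ := coneFrame_spec hS hI hIo hM hs hy
  obtain ⟨e0, e1, e2⟩ := coneFrame_eq (v := v) hS hy (show 0 < s from hI hs)
  have k10 : secondFundamentalForm (coneOver v I S) (v + s • y) (linkFrame S y 1)
      (linkFrame S y 0) = 0 := by
    rw [← e1, ← e2, hM.secondFundamentalForm_symm hx (hm 2) (hm 1), e1, e2, k01]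
  obtain ⟨b, hb⟩ := exists_orthonormalBasis_of_orthonormal (hM.finrank_tangentSpace hx) ho hm
  obtain ⟨B, hB⟩ := hM.exists_bilinear_secondFundamentalForm hx
  have hB0 : B = 0 := by
    refine b.toBasis.ext fun i => b.toBasis.ext fun j => ?_
    have hl := fun w hw => secondFundamentalForm_ruling_left hS hI hIo (d := 2) hM hs hy (w := w) hw
    have hr := fun w hw => secondFundamentalForm_ruling_right hS hI hIo (d := 2) hM hs hy (w := w) hw
    have hi := hm i
    have hj := hm j
    simp only [OrthonormalBasis.coe_toBasis, hB, hb, LinearMap.zero_apply]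
    fin_cases i <;> fin_cases j <;> simp_all
  have := hB ⟨a, ha⟩ ⟨w, hw⟩
  rw [hB0] at this
  exact this.symm

/-- A split twisted-austere pair over an austere cone of dimension three which is not totally
geodesic is of the form `d (m s)`. -/
theorem split_austere_cone (hIc : I.OrdConnected) (hconn : IsConnected (coneOver v I S))
    (hpair : IsTwistedAusterePair 3 θ (coneOver v I S) μ) (hA : IsAustere (coneOver v I S))
    (hng : ¬ IsTotallyGeodesic (coneOver v I S)) (hsplit : IsSplit v (coneOver v I S) μ) :
    (Real.cos (cophase N 3 θ) ≠ 0 ∧ Real.tan (cophase N 3 θ) = 0) ∧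
    IsMinimalSurfaceInSphere S ∧
    ∃ m : E N → ℝ, ContDiffOn ℝ ∞ m S ∧
      (∀ s ∈ I, ∀ y ∈ S, slope v μ (v + s • y) = m y) ∧
      (∀ y ∈ S, laplacian S m y = -2 * m y) ∧
      IsDifferentialOn (coneOver v I S) (homogeneousExtension v m) μ := by
  have hμ := hpair.smooth
  obtain ⟨-, s₀, hs₀, -⟩ := hconn.nonempty
  have hSM : IsSubmanifold 2 S := IsSubmanifold.of_coneOver hS hI hM hIo hs₀
  have hρ : ∀ s ∈ I, ∀ y ∈ S, rulingVector v (v + s • y) = y := fun s hs y hy =>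
    rulingVector_add_smul (hI hs) (norm_eq_one_of_subset_sphere hS hy)
  have hSc : IsPreconnected S := by
    have himg : rulingVector v '' coneOver v I S = S := by
      refine Set.Subset.antisymm (mapsTo_rulingVector hS hI).image_subset fun y hy => ?_
      exact ⟨_, mem_coneOver hs₀ hy, hρ s₀ hs₀ y hy⟩
    rw [← himg]
    exact hconn.isPreconnected.image _
      (contDiffOn_rulingVector.continuousOn.mono (coneOver_subset_compl hS hI))
  have hsp : ∀ s ∈ I, ∀ y ∈ S, ∀ w ∈ tangentSpace S y,
      covariantDerivative (coneOver v I S) μ (v + s • y) y w = 0 ∧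
      covariantDerivative (coneOver v I S) μ (v + s • y) w y = 0 := by
    intro s hs y hy w hw
    have := hsplit _ (mem_coneOver hs hy) w (tangentSpace_le_coneOver hS hI hIo hs hy hw)
    rw [hρ s hs y hy] at this
    exact this (inner_tangentSpace_eq_zero hS hy hw)
  have heq := (isSpecialLagrangian_coneOver_iff hS hI hIo hM hμ hsp).1 hpair.specialLagrangian
  -- the restriction of `μ` to the link does not depend on the distance from the vertex
  have hμw : ∀ y ∈ S, ∀ w ∈ tangentSpace S y, ∀ s ∈ I, ∀ s' ∈ I,
      μ (v + s • y) w = μ (v + s' • y) w := by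
    intro y hy w hw s hs s' hs'
    refine eq_of_hasDerivAt_zero hIo hIc (f := fun σ => μ (v + σ • y) w) (fun σ hσ => ?_) hs hs'
    have := hasDerivAt_along_ruling hμ hσ hy hIo w
    rwa [← covariantDerivative_ruling_left hS hI hIo (d := 2) hM hμ hσ hy
      (tangentSpace_le_coneOver hS hI hIo hσ hy hw), (hsp σ hσ y hy w hw).1] at this
  have hslope : ∀ s ∈ I, ∀ y ∈ S,
      HasFDerivWithinAt (fun z => μ (v + s • z) z) (μ (v + s • y)) S y := by
    intro s hs y hy
    refine hSM.hasFDerivWithinAt_congr hy (hasFDerivWithinAt_slope_link hμ hs hy) fun w hw => ?_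
    have := covariantDerivative_ruling_right hS hI hIo (d := 2) hM hμ hs hy
      (tangentSpace_le_coneOver hS hI hIo hs hy hw)
    rw [(hsp s hs y hy w hw).2] at this
    simp [← this]
  -- The slopes at distances `s` and `s₀` have the same differential on the link, which is connected
  -- as the image of the cone.
  have hg : ∀ s ∈ I, ∀ y ∈ S, ∀ z ∈ S,
      μ (v + s • y) y - μ (v + s₀ • y) y = μ (v + s • z) z - μ (v + s₀ • z) z := by
    intro s hs y hy z hz
    refine hSM.eq_of_hasFDerivWithinAt_zero hSc
      (f := fun y => μ (v + s • y) y - μ (v + s₀ • y) y) (fun x hx => ?_) hy hz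
    refine hSM.hasFDerivWithinAt_congr hx ((hslope s hs x hx).sub (hslope s₀ hs₀ x hx))
      fun w hw => ?_
    simp [hμw x hx w hw s hs s₀ hs₀]
  have hder : ∀ s ∈ I, ∀ y ∈ S, HasDerivAt (fun σ : ℝ => μ (v + σ • y) y)
      (covariantDerivative (coneOver v I S) μ (v + s • y) y y) s := by
    intro s hs y hy
    rw [covariantDerivative_ruling_left hS hI hIo (d := 2) hM hμ hs hy
      (ruling_mem_tangentSpace hS hI hIo hs hy)]
    exact hasDerivAt_along_ruling hμ hs hy hIo y
  have hb : ∀ s ∈ I, ∀ y ∈ S, ∀ z ∈ S,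
      covariantDerivative (coneOver v I S) μ (v + s • y) y y =
        covariantDerivative (coneOver v I S) μ (v + s • z) z z := by
    intro s hs y hy z hz
    refine ((hder s hs y hy).sub_const (μ (v + s₀ • y) y)).unique
      (((hder s hs z hz).sub_const (μ (v + s₀ • z) z)).congr_of_eventuallyEq ?_)
    filter_upwards [hIo.mem_nhds hs] with σ hσ using hg σ hσ y hy z hz
  let m : E N → ℝ := fun z => μ (v + s₀ • z) z
  have hm : ∀ s ∈ I, ∀ z ∈ S, ∀ w ∈ tangentSpace S z,
      fderivWithin ℝ m S z w = μ (v + s • z) w := by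
    intro s hs z hz w hw
    rw [fderivWithin_apply_eq (hslope s₀ hs₀ z hz) hw, hμw z hz w hw s₀ hs₀ s hs]
  have hlap := fun s hs y hy => laplacian_link (μ := μ) (m := m) hS hI hIo hM (s := s) hs (y := y) hy
    hμ (hm s hs)
  -- the equations along a ruling where the second fundamental form does not vanish
  obtain ⟨y₁, hy₁, hII⟩ := exists_secondFundamentalForm_ne_zero hS hI hIo hM hA hng
  have hy₁eq : ∀ s ∈ I, Real.sin (cophase N 3 θ) + Real.cos (cophase N 3 θ) *
        covariantDerivative (coneOver v I S) μ (v + s • y₁) y₁ y₁ = 0 ∧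
      covariantDerivative (coneOver v I S) μ (v + s • y₁) (linkFrame S y₁ 0) (linkFrame S y₁ 0) +
        covariantDerivative (coneOver v I S) μ (v + s • y₁) (linkFrame S y₁ 1)
          (linkFrame S y₁ 1) = 0 := by
    intro s hs
    obtain ⟨hsym, hph⟩ := heq s hs y₁ hy₁
    have hx := mem_coneOver (v := v) hs hy₁
    have hl : ∀ i, linkFrame S y₁ i ∈ tangentSpace (coneOver v I S) (v + s • y₁) := fun i =>
      tangentSpace_le_coneOver hS hI hIo hs hy₁ (linkFrame_mem S y₁ i)
    set x := v + s • y₁ with hxdef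
    set e₁ := linkFrame S y₁ 0 with he₁
    set e₂ := linkFrame S y₁ 1 with he₂
    have hmean := hA.meanCurvature_eq_zero hS hI hIo hM hs hy₁
    rw [← hxdef, ← he₁, ← he₂] at hmean
    have hν : ∃ ν ∈ (tangentSpace (coneOver v I S) x)ᗮ,
        ⟪ν, secondFundamentalForm (coneOver v I S) x e₁ e₁⟫_ℝ ≠ 0 ∨
        ⟪ν, secondFundamentalForm (coneOver v I S) x e₁ e₂⟫_ℝ ≠ 0 := by
      rcases hII s hs with h | h
      · exact ⟨_, secondFundamentalForm_mem x e₁ e₁, Or.inl (inner_self_ne_zero.2 h)⟩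
      · exact ⟨_, secondFundamentalForm_mem x e₁ e₂, Or.inr (inner_self_ne_zero.2 h)⟩
    obtain ⟨ν, hνn, hν⟩ := hν
    -- The phase condition holds for every multiple `τ • ν`, which supplies the one-parameter
    -- family.
    refine splitPhase_family_eq_zero (r := covariantDerivative (coneOver v I S) μ x e₁ e₂) hν
      fun τ => ?_
    have h := hph (τ • ν) (Submodule.smul_mem _ _ hνn) _ fun _ _ => rfl
    rw [secondFundamentalForm_ruling_left hS hI hIo (d := 2) hM hs hy₁
      (ruling_mem_tangentSpace hS hI hIo hs hy₁), inner_zero_right, sub_zero,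
      hsym _ (hl 1) _ (hl 0), hM.secondFundamentalForm_symm hx (hl 1) (hl 0),
      eq_neg_of_add_eq_zero_right hmean, inner_neg_right, real_inner_smul_left,
      real_inner_smul_left, sub_neg_eq_add] at h
    exact h
  -- On this ruling the trace term is zero, so twice the slope is `-Δm(y₁)` at every distance.
  have hconst : ∀ s ∈ I, μ (v + s • y₁) y₁ = m y₁ := by
    intro s hs
    have h1 := hlap s hs y₁ hy₁
    have h2 := hlap s₀ hs₀ y₁ hy₁
    rw [(hy₁eq s hs).2] at h1
    rw [(hy₁eq s₀ hs₀).2] at h2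
    show _ = μ (v + s₀ • y₁) y₁
    linarith
  have hb0 : ∀ s ∈ I, ∀ y ∈ S, covariantDerivative (coneOver v I S) μ (v + s • y) y y = 0 := by
    intro s hs y hy
    -- `b` is the same at all points at distance `s`, so the single ruling through `y₁` decides it.
    rw [hb s hs y hy y₁ hy₁]
    refine (hder s hs y₁ hy₁).unique ((hasDerivAt_const s (m y₁)).congr_of_eventuallyEq ?_)
    filter_upwards [hIo.mem_nhds hs] with σ hσ using hconst σ hσ
  have hsin : Real.sin (cophase N 3 θ) = 0 := by
    have := (hy₁eq s₀ hs₀).1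
    rwa [hb0 s₀ hs₀ y₁ hy₁, mul_zero, add_zero] at this
  have hcos : Real.cos (cophase N 3 θ) ≠ 0 := by
    intro h
    have := Real.sin_sq_add_cos_sq (cophase N 3 θ)
    simp [hsin, h] at this
  have htr : ∀ s ∈ I, ∀ y ∈ S,
      covariantDerivative (coneOver v I S) μ (v + s • y) (linkFrame S y 0) (linkFrame S y 0) +
        covariantDerivative (coneOver v I S) μ (v + s • y) (linkFrame S y 1)
          (linkFrame S y 1) = 0 := by
    intro s hs y hy
    -- With `ν = 0` the second fundamental form drops out, so points with `II = 0` are covered too.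
    have h := (heq s hs y hy).2 0 (zero_mem _) _ fun _ _ => rfl
    simp only [splitPhase, inner_zero_left, sub_zero, hb0 s hs y hy, hsin, zero_mul, zero_add] at h
    exact (mul_eq_zero.1 h).resolve_left hcos
  have hsm : ∀ s ∈ I, ∀ y ∈ S, μ (v + s • y) y = m y := by
    intro s hs y hy
    refine eq_of_hasDerivAt_zero hIo hIc (f := fun σ => μ (v + σ • y) y) (fun σ hσ => ?_) hs hs₀
    have := hder σ hσ y hy
    rwa [hb0 σ hσ y hy] at this
  refine ⟨⟨hcos, by rw [Real.tan_eq_sin_div_cos, hsin, zero_div]⟩, ⟨hS, hSM, fun y hy => ?_⟩,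
    m, ?_, fun s hs y hy => ?_, fun y hy => ?_, ?_⟩
  · rw [meanCurvature_link hS hI hIo hM hs₀ hy, hA.meanCurvature_eq_zero hS hI hIo hM hs₀ hy,
      smul_zero]
  · have hc : ContDiffOn ℝ ∞ (fun z : E N => v + s₀ • z) S :=
      (contDiff_const.add (contDiff_id.const_smul s₀)).contDiffOn
    exact (hμ.comp hc fun z hz => mem_coneOver hs₀ hz).clm_apply contDiffOn_id
  · rw [slope, hρ s hs y hy, hsm s hs y hy]
  · rw [hlap s₀ hs₀ y hy, htr s₀ hs₀ y hy]
    ring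
  · rintro x ⟨s, hs, y, hy, rfl⟩
    obtain ⟨f', hf', hf0, hfw⟩ := hasFDerivWithinAt_homogeneousExtension (v := v) hS hI hs hy
      (hslope s₀ hs₀ y hy)
    refine hM.hasFDerivWithinAt_congr (mem_coneOver hs hy) hf' ?_
    refine eqOn_tangentSpace_coneOver hS hI hIo hs hy ?_ fun w hw => ?_
    · rw [hf0, hsm s hs y hy]
    · rw [hfw w hw, hμw y hy w hw s₀ hs₀ s hs]

end

/-! ### The converse: pairs built from minimal surfaces -/

section

variable {N : ℕ} {v : E N} {S : Set (E N)} {μ : E N → (E N →L[ℝ] ℝ)} {θ : ℝ} {m : E N → ℝ}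
  (hmin : IsMinimalSurfaceInSphere S) (hm : ContDiffOn ℝ ∞ m S)
include hmin hm

theorem exists_differential_homogeneousExtension :
    ∃ μ : E N → (E N →L[ℝ] ℝ), ContDiffOn ℝ ∞ μ (coneOver v (Set.Ioi 0) S) ∧
      IsDifferentialOn (coneOver v (Set.Ioi 0) S) (homogeneousExtension v m) μ := by
  have hS := hmin.subset_sphere
  have hI : Set.Ioi (0 : ℝ) ⊆ Set.Ioi 0 := subset_rfl
  have hM := IsSubmanifold.coneOver (v := v) hS hI hmin.submanifold isOpen_Ioi
  have hsub := coneOver_subset_compl (v := v) hS hI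
  have hn : ContDiffOn ℝ ∞ (fun x : E N => ‖x - v‖) {v}ᶜ := fun x hx =>
    (ContDiffAt.norm ℝ (contDiffAt_id.sub contDiffAt_const) (sub_ne_zero.2 hx)).contDiffWithinAt
  have hf : ContDiffOn ℝ ∞ (homogeneousExtension v m) (coneOver v (Set.Ioi 0) S) :=
    (hn.mono hsub).mul (hm.comp (contDiffOn_rulingVector.mono hsub) (mapsTo_rulingVector hS hI))
  exact ⟨_, hM.differentialForm_spec hf⟩

/-- The pairs `d (m s)` over the cone of a minimal surface in the sphere are twisted-austere. -/
theorem isTwistedAusterePair_homogeneousExtension (hlap : ∀ y ∈ S, laplacian S m y = -2 * m y)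
    (hμ : ContDiffOn ℝ ∞ μ (coneOver v (Set.Ioi 0) S))
    (hd : IsDifferentialOn (coneOver v (Set.Ioi 0) S) (homogeneousExtension v m) μ)
    (hcos : Real.cos (cophase N 3 θ) ≠ 0) (htan : Real.tan (cophase N 3 θ) = 0) :
    IsTwistedAusterePair 3 θ (coneOver v (Set.Ioi 0) S) μ := by
  have hS := hmin.subset_sphere
  have hI : Set.Ioi (0 : ℝ) ⊆ Set.Ioi 0 := subset_rfl
  have hIo : IsOpen (Set.Ioi (0 : ℝ)) := isOpen_Ioi
  set I := Set.Ioi (0 : ℝ) with hIdef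
  have hM : IsSubmanifold 3 (coneOver v I S) :=
    IsSubmanifold.coneOver (v := v) hS hI hmin.submanifold hIo
  have hsin : Real.sin (cophase N 3 θ) = 0 := by
    rw [Real.tan_eq_sin_div_cos] at htan
    exact (div_eq_zero_iff.1 htan).resolve_right hcos
  have hval : ∀ s ∈ I, ∀ y ∈ S, μ (v + s • y) y = m y ∧
      ∀ w ∈ tangentSpace S y, fderivWithin ℝ m S y w = μ (v + s • y) w := by
    intro s hs y hy
    obtain ⟨f', hf', hf0, hfw⟩ := hasFDerivWithinAt_homogeneousExtension (v := v) hS hI hs hy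
      (hasFDerivWithinAt_of_contDiffOn hm hy)
    have h := fun w hw => eqOn_tangentSpace (hd _ (mem_coneOver hs hy)) hf' (w := w) hw
    refine ⟨?_, fun w hw => ?_⟩
    · rw [h _ (ruling_mem_tangentSpace hS hI hIo hs hy), hf0]
    · rw [h _ (tangentSpace_le_coneOver hS hI hIo hs hy hw), hfw w hw]
  have hsymm : ∀ s ∈ I, ∀ y ∈ S, ∀ a ∈ tangentSpace (coneOver v I S) (v + s • y),
      ∀ b ∈ tangentSpace (coneOver v I S) (v + s • y),
        covariantDerivative (coneOver v I S) μ (v + s • y) a b =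
          covariantDerivative (coneOver v I S) μ (v + s • y) b a := by
    intro s hs y hy a ha b hb
    have hx := mem_coneOver (v := v) hs hy
    have hμ' := hasFDerivWithinAt_of_contDiffOn hμ hx
    rw [hM.covariantDerivative_eq hx hμ' ha hb, hM.covariantDerivative_eq hx hμ' hb ha,
      hM.deriv_symm_of_isDifferentialOn hx hd hμ' ha hb, hM.secondFundamentalForm_symm hx ha hb]
  -- `μ = d(ms)` takes the value `m y` on `y` and `dm(w)` on link vectors `w`, both independent of
  -- the distance; hence `(∇μ)(e₀, ·) = 0`.
  have hleft : ∀ s ∈ I, ∀ y ∈ S, ∀ w ∈ tangentSpace (coneOver v I S) (v + s • y), ∀ c : ℝ,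
      (∀ σ ∈ I, μ (v + σ • y) w = c) →
        covariantDerivative (coneOver v I S) μ (v + s • y) y w = 0 := by
    intro s hs y hy w hw c hc
    rw [covariantDerivative_ruling_left hS hI hIo (d := 2) hM hμ hs hy hw]
    refine (hasDerivAt_along_ruling hμ hs hy hIo w).unique
      ((hasDerivAt_const s c).congr_of_eventuallyEq ?_)
    filter_upwards [hIo.mem_nhds hs] with σ hσ using hc σ hσ
  have hyy : ∀ s ∈ I, ∀ y ∈ S, covariantDerivative (coneOver v I S) μ (v + s • y) y y = 0 :=
    fun s hs y hy => hleft s hs y hy y (ruling_mem_tangentSpace hS hI hIo hs hy) (m y)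
      fun σ hσ => (hval σ hσ y hy).1
  have hsplit : ∀ s ∈ I, ∀ y ∈ S, ∀ w ∈ tangentSpace S y,
      covariantDerivative (coneOver v I S) μ (v + s • y) y w = 0 ∧
      covariantDerivative (coneOver v I S) μ (v + s • y) w y = 0 := by
    intro s hs y hy w hw
    have hw' := tangentSpace_le_coneOver (v := v) hS hI hIo hs hy hw
    have h := hleft s hs y hy w hw' (fderivWithin ℝ m S y w)
      fun σ hσ => ((hval σ hσ y hy).2 w hw).symm
    exact ⟨h, by rw [hsymm s hs y hy _ hw' _ (ruling_mem_tangentSpace hS hI hIo hs hy), h]⟩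
  refine ⟨hM, hμ, (isSpecialLagrangian_coneOver_iff hS hI hIo hM hμ hsplit).2
    fun s hs y hy => ⟨hsymm s hs y hy, fun ν hν c hc => ?_⟩⟩
  have hs0 : s ≠ 0 := (show (0 : ℝ) < s from hs).ne'
  have htr : covariantDerivative (coneOver v I S) μ (v + s • y) (linkFrame S y 0)
        (linkFrame S y 0) + covariantDerivative (coneOver v I S) μ (v + s • y) (linkFrame S y 1)
          (linkFrame S y 1) = 0 := by
    have h := laplacian_link hS hI hIo hM hs hy hμ (m := m) fun z hz => (hval s hs z hz).2
    rw [hlap y hy, (hval s hs y hy).1] at h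
    exact (mul_eq_zero.1 (by linarith : s * _ = 0)).resolve_left hs0
  have hmean := meanCurvature_link (v := v) hS hI hIo hM hs hy
  rw [hmin.minimal y hy] at hmean
  have hmean' := congrArg (fun u => ⟪ν, u⟫_ℝ) ((smul_eq_zero.1 hmean.symm).resolve_left hs0)
  simp only [inner_add_right, inner_zero_right] at hmean'
  have hc0 : c y y = 0 := by
    rw [hc, hyy s hs y hy, secondFundamentalForm_ruling_left hS hI hIo (d := 2) hM hs hy
      (ruling_mem_tangentSpace hS hI hIo hs hy), inner_zero_right, sub_zero]
  have hc1 : c (linkFrame S y 0) (linkFrame S y 0) + c (linkFrame S y 1) (linkFrame S y 1) = 0 := by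
    rw [hc, hc]
    linarith
  -- The surviving determinant occurs only multiplied by `sin φ` or by `b`, and both are zero.
  rw [splitPhase, hc0, hc1, hsin]
  ring

end

end TwistedAustere

end

theorem theorem5p5 (n : ℕ) (v : TwistedAustere.E (n + 1)) :
    -- an austere base which is a cone, in the split case
    (∀ (S : Set (TwistedAustere.E (n + 1))) (I : Set ℝ)
        (μ : TwistedAustere.E (n + 1) → (TwistedAustere.E (n + 1) →L[ℝ] ℝ)) (θ : ℝ),
      S ⊆ Metric.sphere 0 1 → IsOpen I → I.OrdConnected → I ⊆ Set.Ioi 0 →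
      IsConnected (TwistedAustere.coneOver v I S) →
      TwistedAustere.IsTwistedAusterePair 3 θ (TwistedAustere.coneOver v I S) μ →
      TwistedAustere.IsAustere (TwistedAustere.coneOver v I S) →
      ¬ TwistedAustere.IsTotallyGeodesic (TwistedAustere.coneOver v I S) →
      TwistedAustere.IsSplit v (TwistedAustere.coneOver v I S) μ →
        (Real.cos (TwistedAustere.cophase (n + 1) 3 θ) ≠ 0 ∧
          Real.tan (TwistedAustere.cophase (n + 1) 3 θ) = 0) ∧
        TwistedAustere.IsMinimalSurfaceInSphere S ∧
        ∃ m : TwistedAustere.E (n + 1) → ℝ, ContDiffOn ℝ ∞ m S ∧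
          (∀ s ∈ I, ∀ y ∈ S, TwistedAustere.slope v μ (v + s • y) = m y) ∧
          (∀ y ∈ S, TwistedAustere.laplacian S m y = -2 * m y) ∧
          TwistedAustere.IsDifferentialOn (TwistedAustere.coneOver v I S)
            (TwistedAustere.homogeneousExtension v m) μ) ∧
    -- the converse
    (∀ (S : Set (TwistedAustere.E (n + 1))) (m : TwistedAustere.E (n + 1) → ℝ),
      TwistedAustere.IsMinimalSurfaceInSphere S → ContDiffOn ℝ ∞ m S →
      (∀ y ∈ S, TwistedAustere.laplacian S m y = -2 * m y) →
        (∃ μ : TwistedAustere.E (n + 1) → (TwistedAustere.E (n + 1) →L[ℝ] ℝ),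
          ContDiffOn ℝ ∞ μ (TwistedAustere.coneOver v (Set.Ioi 0) S) ∧
          TwistedAustere.IsDifferentialOn (TwistedAustere.coneOver v (Set.Ioi 0) S)
            (TwistedAustere.homogeneousExtension v m) μ) ∧
        ∀ μ : TwistedAustere.E (n + 1) → (TwistedAustere.E (n + 1) →L[ℝ] ℝ),
          ContDiffOn ℝ ∞ μ (TwistedAustere.coneOver v (Set.Ioi 0) S) →
          TwistedAustere.IsDifferentialOn (TwistedAustere.coneOver v (Set.Ioi 0) S)
            (TwistedAustere.homogeneousExtension v m) μ →
          ∀ θ : ℝ, Real.cos (TwistedAustere.cophase (n + 1) 3 θ) ≠ 0 →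
            Real.tan (TwistedAustere.cophase (n + 1) 3 θ) = 0 →
            TwistedAustere.IsTwistedAusterePair 3 θ
              (TwistedAustere.coneOver v (Set.Ioi 0) S) μ) := by
  refine ⟨fun S I μ θ hS hIo hIc hI hconn hpair hA hng hsplit =>
    TwistedAustere.split_austere_cone hS hI hIo hpair.submanifold hIc hconn hpair hA hng hsplit,
    fun S m hmin hm hlap =>
      ⟨TwistedAustere.exists_differential_homogeneousExtension hmin hm,
        fun μ hμ hd θ hcos htan =>
          TwistedAustere.isTwistedAusterePair_homogeneousExtension hmin hm hlap hμ hd hcos htan⟩⟩
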